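/- Let $(\Lambda,\Sigma,\mu)$ be any measure space and let $(H_\lambda)_{\lambda\in\Lambda}$ be a measurable field of complex Hilbert spaces over it, that is, a family with a linear space of sections, called measurable, such that $\lambda\mapsto\|x_\lambda\|$ is measurable for each measurable section $x$, every section whose inner products with all measurable sections are measurable is itself measurable, and some sequence of measurable sections is total in every $H_\lambda$. Let $H=\int_\Lambda^\oplus H_\lambda\,d\mu(\lambda)$ be its direct integral (the measurable sections with $\int\|x_\lambda\|^2d\mu<\infty$, modulo equality a.e.), and assume $H\neq\{0\}$. For a compact operator $T$ on a Hilbert space let $s_1(T)\ge s_2(T)\ge\dots$ be the positive eigenvalues of $(T^*T)^{1/2}$ repeated according to multiplicity, continued by zeros if there are only finitely many. Let $C_\infty$ denote the compact operators, and for $1\le p<\infty$ let $C_p$ denote the compact operators with $\sum_k s_k(T)^p<\infty$. **Theorem 3.5.** Let $A_\lambda\in C_\infty(H_\lambda)$ for every $\lambda\in\Lambda$, and let $A\in C_\infty(H)$ satisfy $A=\int_\Lambda^\oplus A_\lambda\,d\mu(\lambda)$, i.e. for every $x\in H$, $(Ax)_\lambda=A_\lambda x_\lambda$ for almost every $\lambda$.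 Then there is a nonempty countable (finite or infinite) subset $\Lambda^*=\{\lambda_1,\dots,\lambda_n\}$, $n\le\infty$, of $\Lambda$ (the $\lambda_m$ distinct) such that all of the following hold. 1. The nonzero singular numbers of $A$ are, counted with multiplicity, the nonzero singular numbers of the $A_{\lambda_m}$ taken together: for every $s>0$, $\#\{k: s_k(A)=s\}=\#\{(m,q): s_q(A_{\lambda_m})=s\}$. In particular, $\{s_k(A):k\ge1\}\setminus\{0\}=\bigcup_{m=1}^n\{s_q(A_{\lambda_m}):q\ge1\}\setminus\{0\}$. 2. If $1\le p<\infty$ and $A\in C_p(H)$, then $A_{\lambda_m}\in C_p(H_{\lambda_m})$ for every $m$. 3. (a) Suppose $n<\infty$, $1\le p(\lambda_m)<\infty$, $A_{\lambda_m}\in C_{p(\lambda_m)}(H_{\lambda_m})$ for every $m$, and $p=\sup_m p(\lambda_m)$. Then $A\in C_p(H)$ if and only if $\sum_{m=1}^n\sum_{q=1}^\infty s_q(A_{\lambda_m})^{p(\lambda_m)}$ converges. (b) For $n\le\infty$ and every $1\le p<\infty$, $A\in C_p(H)$ if and only if $\sum_{m=1}^n\sum_{q=1}^\infty s_q(A_{\lambda_m})^{p}$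 converges. 4. If $n\le\infty$, $1\le p(\lambda_m)<\infty$, $A_{\lambda_m}\in C_{p(\lambda_m)}(H_{\lambda_m})$ for every $m$, $p=\sup_m p(\lambda_m)<\infty$ and $\sum_{m=1}^n\sum_{q=1}^\infty s_q(A_{\lambda_m})^{p(\lambda_m)}$ converges, then $A\in C_p(H)$. 5. If, for every $m$, $1\le p(\lambda_m)<\infty$, $A_{\lambda_m}\in C_{p(\lambda_m)}(H_{\lambda_m})$ and $p(\lambda_m)=\inf\{\alpha\in[1,\infty):A_{\lambda_m}\in C_\alpha(H_{\lambda_m})\}$, and if $\sup_m p(\lambda_m)=\infty$, then $A\notin C_p(H)$ for every $1\le p<\infty$. 6. If, for every $m$, $1\le p(\lambda_m)\le\infty$, $A_{\lambda_m}\in C_{p(\lambda_m)}(H_{\lambda_m})$ and $p(\lambda_m)=\inf\{\alpha\in[1,\infty):A_{\lambda_m}\in C_\alpha(H_{\lambda_m})\}$ (with $\inf\emptyset=\infty$), if $\sup_m p(\lambda_m)=\infty$, and if $A_{\lambda_k}\in C_\infty(H_{\lambda_k})$ for some $k$, then $A\notin C_p(H)$ for every $1\le p<\infty$. -/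

import Mathlib

open MeasureTheory Filter Topology
open scoped ENNReal

universe u v

section DirectIntegralSpace

/-- A measurable field of complex Hilbert spaces `i ↦ H i` over a measurable space `Λ`: a linear
space of sections, called measurable, such that the norm of a measurable section is a measurable
function, a section whose inner products with all measurable sections are measurable functions is
itself measurable, and some sequence of measurable sections is total in every fibre. -/
structure HilbertField (Λ : Type u) [MeasurableSpace Λ] (H : Λ → Type v)
    [∀ i, NormedAddCommGroup (H i)] [∀ i, InnerProductSpace ℂ (H i)] where
  sections : Submodule ℂ (∀ i, H i)
  measurable_norm : ∀ x ∈ sections, Measurable fun i => ‖x i‖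
  mem_of_measurable_inner : ∀ y : ∀ i, H i,
    (∀ x ∈ sections, Measurable fun i => inner ℂ (x i) (y i)) → y ∈ sections
  exists_fundamental : ∃ e : ℕ → ∀ i, H i, (∀ n, e n ∈ sections) ∧
    ∀ i, (Submodule.span ℂ (Set.range fun n => e n i)).topologicalClosure = ⊤

variable {Λ : Type u} [MeasurableSpace Λ] {H : Λ → Type v}
  [∀ i, NormedAddCommGroup (H i)] [∀ i, InnerProductSpace ℂ (H i)]

namespace HilbertField

theorem measurable_inner (F : HilbertField Λ H) {x y : ∀ i, H i}
    (hx : x ∈ F.sections) (hy : y ∈ F.sections) :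
    Measurable fun i => inner ℂ (x i) (y i) := by
  have h1 := F.measurable_norm _ (F.sections.add_mem hx hy)
  have h2 := F.measurable_norm _ (F.sections.sub_mem hx hy)
  have h3 := F.measurable_norm _
    (F.sections.sub_mem hx (F.sections.smul_mem (RCLike.I : ℂ) hy))
  have h4 := F.measurable_norm _
    (F.sections.add_mem hx (F.sections.smul_mem (RCLike.I : ℂ) hy))
  simp only [Pi.add_apply, Pi.sub_apply, Pi.smul_apply] at h1 h2 h3 h4
  simp only [inner_eq_sum_norm_sq_div_four]
  fun_prop

variable (μ : Measure Λ) (F : HilbertField Λ H)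

/-- The measurable sections `x` with `∫ ‖x i‖² dμ(i) < ∞`. -/
def l2Submodule : Submodule ℂ (∀ i, H i) where
  carrier := {x | x ∈ F.sections ∧ MemLp (fun i => ‖x i‖) 2 μ}
  zero_mem' := ⟨F.sections.zero_mem, by simp⟩
  add_mem' := by
    rintro x y ⟨hx, hx2⟩ ⟨hy, hy2⟩
    refine ⟨F.sections.add_mem hx hy, (hx2.add hy2).mono
      (F.measurable_norm _ (F.sections.add_mem hx hy)).aestronglyMeasurable
      (Eventually.of_forall fun i => ?_)⟩
    simp only [Pi.add_apply, Real.norm_eq_abs, abs_norm]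
    exact (norm_add_le _ _).trans (le_abs_self _)
  smul_mem' := by
    rintro c x ⟨hx, hx2⟩
    refine ⟨F.sections.smul_mem c hx, ?_⟩
    simpa [norm_smul] using hx2.const_mul ‖c‖

/-- Square-integrable measurable sections, before identification of sections that agree a.e. -/
def L2Section : Type (max u v) := ↥(F.l2Submodule μ)

namespace L2Section

variable {μ F}

instance : AddCommGroup (L2Section μ F) := inferInstanceAs (AddCommGroup ↥(F.l2Submodule μ))

instance : Module ℂ (L2Section μ F) := inferInstanceAs (Module ℂ ↥(F.l2Submodule μ))

instance : CoeFun (L2Section μ F) (fun _ => ∀ i, H i) := ⟨fun x => x.1⟩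

theorem add_apply (x y : L2Section μ F) (i : Λ) : (x + y) i = x i + y i := rfl

theorem sub_apply (x y : L2Section μ F) (i : Λ) : (x - y) i = x i - y i := rfl

theorem smul_apply (c : ℂ) (x : L2Section μ F) (i : Λ) : (c • x) i = c • x i := rfl

theorem integrable_inner (x y : L2Section μ F) :
    Integrable (fun i => inner ℂ (x i) (y i)) μ := by
  have h : Integrable (fun i => ‖x i‖ * ‖y i‖) μ := x.2.2.integrable_mul y.2.2
  refine h.mono (F.measurable_inner x.2.1 y.2.1).aestronglyMeasurable
    (Eventually.of_forall fun i => ?_)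
  rw [norm_mul, norm_norm, norm_norm]
  exact norm_inner_le_norm _ _

/-- The inner product `⟪x, y⟫ = ∫ ⟪x i, y i⟫ dμ(i)`. -/
noncomputable instance core : PreInnerProductSpace.Core ℂ (L2Section μ F) where
  inner x y := ∫ i, inner ℂ (x i) (y i) ∂μ
  conj_inner_symm x y := by
    rw [← integral_conj]
    simp only [inner_conj_symm]
  re_inner_nonneg x := by
    rw [← integral_re (integrable_inner x x)]
    exact integral_nonneg fun i => inner_self_nonneg
  add_left x y z := by
    rw [← integral_add (integrable_inner x z) (integrable_inner y z)]
    simp only [add_apply, inner_add_left]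
  smul_left x y r := by
    rw [← integral_const_mul]
    simp only [smul_apply, inner_smul_left]

noncomputable instance : SeminormedAddCommGroup (L2Section μ F) :=
  InnerProductSpace.Core.toSeminormedAddCommGroup (𝕜 := ℂ)

noncomputable instance : InnerProductSpace ℂ (L2Section μ F) := InnerProductSpace.ofCore core

theorem inner_def (x y : L2Section μ F) : inner ℂ x y = ∫ i, inner ℂ (x i) (y i) ∂μ := rfl

theorem norm_sq_eq (x : L2Section μ F) : ‖x‖ ^ 2 = ∫ i, ‖x i‖ ^ 2 ∂μ := by
  rw [← inner_self_eq_norm_sq (𝕜 := ℂ) x, inner_def, ← integral_re (integrable_inner x x)]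
  simp only [inner_self_eq_norm_sq]

theorem ofReal_norm_sq (x : L2Section μ F) :
    ENNReal.ofReal (‖x‖ ^ 2) = ∫⁻ i, ENNReal.ofReal (‖x i‖ ^ 2) ∂μ := by
  rw [norm_sq_eq, ofReal_integral_eq_lintegral_ofReal x.2.2.integrable_sq
    (Eventually.of_forall fun i => by positivity)]

theorem norm_eq_zero_iff (x : L2Section μ F) : ‖x‖ = 0 ↔ ∀ᵐ i ∂μ, x i = 0 := by
  rw [← sq_eq_zero_iff, norm_sq_eq, integral_eq_zero_iff_of_nonneg (fun i => by positivity)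
    x.2.2.integrable_sq]
  simp [Filter.EventuallyEq]

variable [∀ i, CompleteSpace (H i)]

instance : CompleteSpace (L2Section μ F) := by
  refine Metric.complete_of_convergent_controlled_sequences (fun n => (1 / 2 : ℝ) ^ n)
    (by simp) fun w hw => ?_
  have hd : ∀ n m N, N ≤ n → N ≤ m →
      ∫⁻ i, ENNReal.ofReal (‖w n i - w m i‖ ^ 2) ∂μ ≤ ENNReal.ofReal ((1 / 4) ^ N) := by
    intro n m N hn hm
    have h1 := (hw N n m hn hm).le
    rw [dist_eq_norm] at h1
    have h2 : ‖w n - w m‖ ^ 2 ≤ (1 / 4 : ℝ) ^ N := by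
      calc ‖w n - w m‖ ^ 2 ≤ ((1 / 2 : ℝ) ^ N) ^ 2 := by gcongr
        _ = (1 / 4 : ℝ) ^ N := by rw [← pow_mul, mul_comm, pow_mul]; norm_num
    exact (ofReal_norm_sq (w n - w m)).symm.le.trans (ENNReal.ofReal_le_ofReal h2)
  have hmeas : ∀ n m, Measurable fun i => ‖w n i - w m i‖ := fun n m =>
    F.measurable_norm _ (F.sections.sub_mem (w n).2.1 (w m).2.1)
  let g : Λ → ℝ≥0∞ := fun i =>
    ∑' n, ENNReal.ofReal (2 ^ n * ‖w (n + 1) i - w n i‖ ^ 2)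
  have hg : Measurable g := by
    refine Measurable.tsum fun n => ?_
    exact (((hmeas (n + 1) n).pow_const 2).const_mul _).ennreal_ofReal
  have hgint : ∫⁻ i, g i ∂μ ≠ ∞ := by
    rw [lintegral_tsum fun n =>
      (((hmeas (n + 1) n).pow_const 2).const_mul _).ennreal_ofReal.aemeasurable]
    have hb : ∀ n : ℕ, ∫⁻ i, ENNReal.ofReal (2 ^ n * ‖w (n + 1) i - w n i‖ ^ 2) ∂μ
        ≤ ENNReal.ofReal ((1 / 2) ^ n) := by
      intro n
      have he : ∀ i, ENNReal.ofReal (2 ^ n * ‖w (n + 1) i - w n i‖ ^ 2)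
          = ENNReal.ofReal (2 ^ n) * ENNReal.ofReal (‖w (n + 1) i - w n i‖ ^ 2) := fun i =>
        ENNReal.ofReal_mul (by positivity)
      simp only [he]
      rw [lintegral_const_mul _ ((hmeas (n + 1) n).pow_const 2).ennreal_ofReal]
      calc _ ≤ ENNReal.ofReal (2 ^ n) * ENNReal.ofReal ((1 / 4) ^ n) := by
              gcongr; exact hd _ _ n (Nat.le_succ n) le_rfl
        _ = ENNReal.ofReal ((1 / 2) ^ n) := by
              rw [← ENNReal.ofReal_mul (by positivity), ← mul_pow]; norm_num
    refine ne_top_of_le_ne_top ?_ (ENNReal.tsum_le_tsum hb)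
    rw [← ENNReal.ofReal_tsum_of_nonneg (fun n => by positivity) summable_geometric_two]
    exact ENNReal.ofReal_ne_top
  have hae : ∀ᵐ i ∂μ, g i < ∞ := ae_lt_top hg hgint
  have hB : MeasurableSet {i | g i < ∞} := hg measurableSet_Iio
  have hconv : ∀ i, g i < ∞ → ∃ a : H i, Tendsto (fun n => w n i) atTop (𝓝 a) := by
    intro i hi
    have hC : ∀ n, 2 ^ n * ‖w (n + 1) i - w n i‖ ^ 2 ≤ (g i).toReal := by
      intro n
      have := ENNReal.toReal_mono hi.ne
        (ENNReal.le_tsum (f := fun n => ENNReal.ofReal (2 ^ n * ‖w (n + 1) i - w n i‖ ^ 2)) n)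
      rwa [ENNReal.toReal_ofReal (by positivity)] at this
    refine cauchySeq_tendsto_of_complete
      (cauchySeq_of_le_geometric (√(1 / 2)) (√(g i).toReal) ?_ fun n => ?_)
    · rw [Real.sqrt_lt' one_pos]; norm_num
    · rw [dist_comm, dist_eq_norm]
      refine abs_le_of_sq_le_sq' ?_ (by positivity) |>.2
      rw [mul_pow, Real.sq_sqrt ENNReal.toReal_nonneg, ← pow_mul, mul_comm n 2, pow_mul,
        Real.sq_sqrt (by norm_num), one_div, inv_pow, ← div_eq_mul_inv, le_div_iff₀ (by positivity),
        mul_comm]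
      exact hC n
  classical
  choose a ha using hconv
  let y : ∀ i, H i := fun i => if h : g i < ∞ then a i h else 0
  have hy : ∀ i, g i < ∞ → Tendsto (fun n => w n i) atTop (𝓝 (y i)) := by
    intro i hi
    simp only [y, dif_pos hi]
    exact ha i hi
  have hyS : y ∈ F.sections := by
    refine F.mem_of_measurable_inner y fun x hx => ?_
    refine measurable_of_tendsto_metrizable
      (f := fun n => Set.indicator {i | g i < ∞} fun i => inner ℂ (x i) (w n i))
      (fun n => (F.measurable_inner hx (w n).2.1).indicator hB) ?_
    rw [tendsto_pi_nhds]
    intro i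
    by_cases hi : g i < ∞
    · have := (tendsto_const_nhds (x := x i)).inner (𝕜 := ℂ) (hy i hi)
      simpa [Set.indicator, hi] using this
    · simp [Set.indicator, hi, y]
  have hlim : ∀ N, ∫⁻ i, ENNReal.ofReal (‖y i - w N i‖ ^ 2) ∂μ ≤ ENNReal.ofReal ((1 / 4) ^ N) := by
    intro N
    calc _ = ∫⁻ i, liminf (fun n => ENNReal.ofReal (‖w n i - w N i‖ ^ 2)) atTop ∂μ := by
            refine lintegral_congr_ae (hae.mono fun i hi => ?_)
            have ht : Tendsto (fun n => ENNReal.ofReal (‖w n i - w N i‖ ^ 2)) atTop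
                (𝓝 (ENNReal.ofReal (‖y i - w N i‖ ^ 2))) :=
              ENNReal.tendsto_ofReal ((((hy i hi).sub_const _).norm).pow 2)
            exact ht.liminf_eq.symm
      _ ≤ liminf (fun n => ∫⁻ i, ENNReal.ofReal (‖w n i - w N i‖ ^ 2) ∂μ) atTop :=
            lintegral_liminf_le fun n => ((hmeas n N).pow_const 2).ennreal_ofReal
      _ ≤ ENNReal.ofReal ((1 / 4) ^ N) := by
            refine liminf_le_of_le (by isBoundedDefault) fun b hb => ?_
            obtain ⟨n, hn, hNn⟩ := (hb.and (eventually_ge_atTop N)).exists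
            exact hn.trans (hd n N N hNn le_rfl)
  have hyw : ∀ N, y - (w N).1 ∈ F.l2Submodule μ := by
    intro N
    have hS := F.sections.sub_mem hyS (w N).2.1
    refine ⟨hS, ?_⟩
    have hm := F.measurable_norm _ hS
    rw [memLp_two_iff_integrable_sq hm.aestronglyMeasurable]
    refine ⟨(hm.pow_const 2).aestronglyMeasurable, ?_⟩
    rw [hasFiniteIntegral_iff_ofReal (Eventually.of_forall fun i => by positivity)]
    exact (hlim N).trans_lt ENNReal.ofReal_lt_top
  have hy2 : y ∈ F.l2Submodule μ := by
    simpa using (F.l2Submodule μ).add_mem (hyw 0) (w 0).2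
  let z : L2Section μ F := ⟨y, hy2⟩
  refine ⟨z, ?_⟩
  rw [tendsto_iff_norm_sub_tendsto_zero]
  refine squeeze_zero (fun n => norm_nonneg _) (fun n => ?_)
    (tendsto_pow_atTop_nhds_zero_of_lt_one (r := (1 / 2 : ℝ)) (by norm_num) (by norm_num))
  have h1 : ENNReal.ofReal (‖z - w n‖ ^ 2)
      ≤ ENNReal.ofReal ((1 / 4) ^ n) := (ofReal_norm_sq _).le.trans (hlim n)
  rw [ENNReal.ofReal_le_ofReal_iff (by positivity)] at h1
  rw [norm_sub_rev]
  refine abs_le_of_sq_le_sq' (h1.trans_eq ?_) (by positivity) |>.2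
  rw [← pow_mul, mul_comm n 2, pow_mul]; norm_num

end L2Section

end HilbertField

/-- The direct integral `∫^⊕ H i dμ(i)`: square-integrable measurable sections modulo sections of
norm zero, i.e. modulo equality almost everywhere (`DirectIntegral.mk_eq_mk_iff`). -/
abbrev DirectIntegral (μ : Measure Λ) (F : HilbertField Λ H) : Type (max u v) :=
  SeparationQuotient (HilbertField.L2Section μ F)

namespace DirectIntegral

variable {μ : Measure Λ} {F : HilbertField Λ H}

/-- The class of a square-integrable measurable section. -/
noncomputable def mk (x : HilbertField.L2Section μ F) : DirectIntegral μ F := SeparationQuotient.mk x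

theorem mk_eq_mk_iff (x y : HilbertField.L2Section μ F) :
    (mk x : DirectIntegral μ F) = mk y ↔ ∀ᵐ i ∂μ, x i = y i := by
  rw [mk, mk, SeparationQuotient.mk_eq_mk, Metric.inseparable_iff, dist_eq_norm,
    HilbertField.L2Section.norm_eq_zero_iff]
  simp only [HilbertField.L2Section.sub_apply, sub_eq_zero]

/-- `A = ∫^⊕ A i dμ(i)`: for every `x` in the direct integral, `(A x) i = A i (x i)` for almost
every `i`. Measurability of `i ↦ A i (x i)` up to null sets is part of this condition, and
nothing is required of `A i` on null sets. -/
def IsDirectIntegral (A : DirectIntegral μ F →L[ℂ] DirectIntegral μ F)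
    (a : ∀ i, H i →L[ℂ] H i) : Prop :=
  ∀ x y : HilbertField.L2Section μ F, A (mk x) = mk y → ∀ᵐ i ∂μ, y i = a i (x i)

end DirectIntegral

end DirectIntegralSpace

section SingularNumbers

variable {E : Type v} [NormedAddCommGroup E] [InnerProductSpace ℂ E] [CompleteSpace E]

/-- The span of the eigenvectors of `T* T` for all eigenvalues `t²` with `t ≥ s`. For `s > 0` its
dimension is the number of eigenvalues `t ≥ s` of `(T* T)^(1/2)`, counted with multiplicity. -/
noncomputable def singularSubspace (T : E →L[ℂ] E) (s : ℝ) : Submodule ℂ E :=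
  ⨆ (t : ℝ) (_ : s ≤ t), Module.End.eigenspace
    ((ContinuousLinearMap.adjoint T ∘L T : E →L[ℂ] E) : E →ₗ[ℂ] E) ((t ^ 2 : ℝ) : ℂ)

/-- The singular numbers of a compact operator: `singularNumber T k` is the `(k + 1)`-st member
`s_{k+1}(T)` of the list of the positive eigenvalues of `(T* T)^(1/2)`, in decreasing order and
repeated according to multiplicity; it is `0` if there are at most `k` of them. -/
noncomputable def singularNumber (T : E →L[ℂ] E) (k : ℕ) : ℝ :=
  sSup {s : ℝ | 0 < s ∧ ((k + 1 : ℕ) : Cardinal) ≤ Module.rank ℂ (singularSubspace T s)}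

/-- The class `C_p` for `1 ≤ p ≤ ∞`: the compact operators for `p = ∞`, and the compact operators
with `∑ s_k(T) ^ p < ∞` for `p < ∞`. -/
def schattenClass (E : Type v) [NormedAddCommGroup E] [InnerProductSpace ℂ E] [CompleteSpace E]
    (p : ℝ≥0∞) : Set (E →L[ℂ] E) :=
  {T | IsCompactOperator T ∧ (p ≠ ∞ → Summable fun k => singularNumber T k ^ p.toReal)}

end SingularNumbers

/-! A decomposable operator `A` commutes with every diagonal projection, i.e. multiplication by the
indicator of a measurable set, and so does its adjoint. Hence each eigenspace of `A* A` for `s² > 0`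
is stable under these projections, and by compactness it is finite-dimensional. Repeated cutting by
measurable sets cannot go on forever inside a finite-dimensional space, so such an eigenspace is
carried by atoms of finite measure (`exists_isFiniteAtom_of_proj_mem`,
`eq_zero_of_forall_proj_eq_zero`).

On a finite atom `B` every measurable function is a.e. constant, in particular all inner products of
a fundamental sequence. So for almost every `i ∈ B` the fibre `H i` has, up to the factor `μ B`, the
same Gram matrix as the fundamental sections cut off to `B`. This gives an isometry of `H i` onto
the range of the projection of `B`, intertwining `a i` with `A` and the adjoints likewise
(`ae_exists_linearIsometry`). The part of an eigenspace of `A* A` lying over `B` therefore has the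
dimension of the corresponding eigenspace of `(a i)* (a i)`.

Only countably many atoms, up to null sets, meet an eigenspace with `s > 0`. One point chosen in
each gives `S`, and adding dimensions over the atoms gives the equality of multiplicities
(`exists_countable_encard_eq`). All statements about Schatten classes then compare sums over two
families whose positive values occur equally often. No σ-finiteness of `μ` enters, because sections
in the direct integral are nonzero only on countable unions of sets of finite measure, up to null
sets. -/

theorem finite_ne_bot_of_iSupIndep_of_le {R M ι : Type*} [DivisionRing R] [AddCommGroup M]
    [Module R M] {N : ι → Submodule R M} (h : iSupIndep N) {W : Submodule R M}
    [FiniteDimensional R W] (hW : ∀ i, N i ≤ W) : {i | N i ≠ ⊥}.Finite := by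
  have hex : ∀ i : {i | N i ≠ ⊥}, ∃ x ∈ N i, x ≠ 0 := fun i => (N i).exists_mem_ne_zero_of_ne_bot i.2
  choose x hx hx0 using hex
  have hli : LinearIndependent R x :=
    iSupIndep.linearIndependent _ (h.comp Subtype.val_injective) hx hx0
  have hli' : LinearIndependent R fun i => (⟨x i, hW i (hx i)⟩ : W) :=
    LinearIndependent.of_comp W.subtype hli
  have := hli'.finite
  exact Set.toFinite _

/-! ### Singular numbers and eigenspaces of `T* T` -/

section SingularNumbers

variable {E : Type v} [NormedAddCommGroup E] [InnerProductSpace ℂ E] [CompleteSpace E]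

/-- The eigenspace of `T* T` for the eigenvalue `t²`. -/
noncomputable def singularEigenspace (T : E →L[ℂ] E) (t : ℝ) : Submodule ℂ E :=
  Module.End.eigenspace
    ((ContinuousLinearMap.adjoint T ∘L T : E →L[ℂ] E) : E →ₗ[ℂ] E) ((t ^ 2 : ℝ) : ℂ)

theorem mem_singularEigenspace {T : E →L[ℂ] E} {t : ℝ} {x : E} :
    x ∈ singularEigenspace T t ↔
      ContinuousLinearMap.adjoint T (T x) = ((t ^ 2 : ℝ) : ℂ) • x := by
  simp [singularEigenspace]

theorem singularSubspace_eq_iSup (T : E →L[ℂ] E) (s : ℝ) :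
    singularSubspace T s = ⨆ t : {t : ℝ // s ≤ t}, singularEigenspace T t := by
  rw [singularSubspace, iSup_subtype']; rfl

theorem singularSubspace_antitone (T : E →L[ℂ] E) : Antitone (singularSubspace T) := by
  intro s t hst
  exact iSup_mono fun r => iSup_mono' fun h => ⟨hst.trans h, le_rfl⟩

theorem singularEigenspace_le (T : E →L[ℂ] E) {s t : ℝ} (h : s ≤ t) :
    singularEigenspace T t ≤ singularSubspace T s :=
  le_iSup₂ (f := fun (t : ℝ) (_ : s ≤ t) => singularEigenspace T t) t h

theorem isSymmetric_adjoint_comp_self (T : E →L[ℂ] E) :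
    ((ContinuousLinearMap.adjoint T ∘L T : E →L[ℂ] E) : E →ₗ[ℂ] E).IsSymmetric := by
  intro x y
  simp [ContinuousLinearMap.adjoint_inner_left, ContinuousLinearMap.adjoint_inner_right]

/-- The index is restricted to `t ≥ 0` because `t` and `-t` give the same eigenspace; on this
half-line squaring is injective. -/
theorem singularEigenspace_orthogonalFamily (T : E →L[ℂ] E) :
    OrthogonalFamily ℂ (fun t : {t : ℝ // 0 ≤ t} => singularEigenspace T t)
      fun t => (singularEigenspace T t).subtypeₗᵢ := by
  refine (isSymmetric_adjoint_comp_self T).orthogonalFamily_eigenspaces.comp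
    (γ := {t : ℝ // 0 ≤ t}) (f := fun t => ((t.1 ^ 2 : ℝ) : ℂ)) ?_
  intro s t h
  have h1 : s.1 ^ 2 = t.1 ^ 2 := Complex.ofReal_injective h
  exact Subtype.ext ((sq_eq_sq₀ s.2 t.2).1 h1)

theorem singularEigenspace_orthogonalFamily_of_le (T : E →L[ℂ] E) {s : ℝ} (hs : 0 ≤ s) :
    OrthogonalFamily ℂ (fun t : {t : ℝ // s ≤ t} => singularEigenspace T t)
      fun t => (singularEigenspace T t).subtypeₗᵢ :=
  (singularEigenspace_orthogonalFamily T).comp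
    (f := fun t : {t : ℝ // s ≤ t} => (⟨t.1, hs.trans t.2⟩ : {t : ℝ // 0 ≤ t}))
    fun _ _ h => Subtype.ext (congrArg (fun t : {t : ℝ // 0 ≤ t} => t.1) h)

/-- Writing `x` as a finite sum of orthogonal eigenvectors `x_t` gives `‖T x‖² = ∑ t² ‖x_t‖²`, with
every `t ≥ s`. -/
theorem norm_le_of_mem_singularSubspace (T : E →L[ℂ] E) {s : ℝ} (hs : 0 ≤ s) {x : E}
    (hx : x ∈ singularSubspace T s) : s * ‖x‖ ≤ ‖T x‖ := by
  classical
  rw [singularSubspace_eq_iSup, Submodule.mem_iSup_iff_exists_dfinsupp'] at hx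
  obtain ⟨f, rfl⟩ := hx
  have hO := singularEigenspace_orthogonalFamily_of_le T hs
  set x : E := f.sum fun _ y => (y : E) with hxd
  have hx1 : x = ∑ i ∈ f.support, (singularEigenspace T i).subtypeₗᵢ (f i) := rfl
  have hx2 : ContinuousLinearMap.adjoint T (T x) = ∑ i ∈ f.support,
      (singularEigenspace T i).subtypeₗᵢ ((((i : ℝ) ^ 2 : ℝ) : ℂ) • f i) := by
    rw [hx1, map_sum, map_sum]
    refine Finset.sum_congr rfl fun i _ => ?_
    simpa using mem_singularEigenspace.1 (f i).2
  have hT : ‖T x‖ ^ 2 = ∑ i ∈ f.support, (i : ℝ) ^ 2 * ‖f i‖ ^ 2 := by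
    rw [← inner_self_eq_norm_sq (𝕜 := ℂ) (T x), ← ContinuousLinearMap.adjoint_inner_left, hx2, hx1,
      hO.inner_sum, map_sum]
    refine Finset.sum_congr rfl fun i _ => ?_
    rw [inner_smul_left, Complex.conj_ofReal, RCLike.re_to_complex, Complex.re_ofReal_mul,
      ← RCLike.re_to_complex, inner_self_eq_norm_sq]
  have hxn : ‖x‖ ^ 2 = ∑ i ∈ f.support, ‖f i‖ ^ 2 := by
    rw [hx1, hO.norm_sum]
  refine abs_le_of_sq_le_sq' ?_ (norm_nonneg _) |>.2
  rw [mul_pow, hT, hxn, Finset.mul_sum]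
  refine Finset.sum_le_sum fun i _ => ?_
  have := i.2
  gcongr

/-- `T` is compact and bounded below on this subspace, so the unit ball of the subspace is totally
bounded and Riesz's theorem applies. -/
theorem finiteDimensional_singularSubspace {T : E →L[ℂ] E} (hT : IsCompactOperator T) {s : ℝ}
    (hs : 0 < s) : FiniteDimensional ℂ (singularSubspace T s) := by
  set W := singularSubspace T s
  let g : W →L[ℂ] E := T ∘L W.subtypeL
  have hg : AntilipschitzWith (Real.toNNReal s)⁻¹ g := by
    refine ContinuousLinearMap.antilipschitz_of_bound g fun x => ?_
    rw [NNReal.coe_inv, Real.coe_toNNReal _ hs.le, inv_mul_eq_div, le_div_iff₀ hs, mul_comm]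
    exact norm_le_of_mem_singularSubspace T hs.le x.2
  obtain ⟨K, hK, hKs⟩ := IsCompactOperator.image_closedBall_subset_compact (f := (g : W →ₗ[ℂ] E))
    (hT.comp_clm W.subtypeL) 1
  refine FiniteDimensional.of_totallyBounded_nhds_zero ℂ
    (Metric.closedBall_mem_nhds (0 : W) one_pos) ?_
  refine (totallyBounded_preimage (hg.isUniformEmbedding g.uniformContinuous).isUniformInducing
    hK.totallyBounded).subset ?_
  exact Set.image_subset_iff.1 hKs

theorem finite_setOf_singularEigenspace_ne_bot {T : E →L[ℂ] E} (hT : IsCompactOperator T) {s : ℝ}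
    (hs : 0 < s) : {t : ℝ | s ≤ t ∧ singularEigenspace T t ≠ ⊥}.Finite := by
  have := finiteDimensional_singularSubspace hT hs
  have h := finite_ne_bot_of_iSupIndep_of_le
    (singularEigenspace_orthogonalFamily_of_le T hs.le).independent
    (W := singularSubspace T s) fun t => singularEigenspace_le T t.2
  refine (h.image Subtype.val).subset ?_
  rintro t ⟨h1, h2⟩
  exact ⟨⟨t, h1⟩, h2, rfl⟩

theorem singularSubspace_le_of_forall {T : E →L[ℂ] E} {s : ℝ} {W : Submodule ℂ E}
    (h : ∀ t, s ≤ t → singularEigenspace T t ≠ ⊥ → singularEigenspace T t ≤ W) :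
    singularSubspace T s ≤ W := by
  rw [singularSubspace_eq_iSup]
  refine iSup_le fun t => ?_
  by_cases ht : singularEigenspace T t = ⊥
  · rw [ht]; exact bot_le
  · exact h t t.2 ht

/-- Only finitely many singular values are at least `s / 2`, so there is a gap just below `s`. This
is what makes a positive supremum in `singularNumber` attained. -/
theorem exists_lt_singularSubspace_eq {T : E →L[ℂ] E} (hT : IsCompactOperator T) {s : ℝ}
    (hs : 0 < s) : ∃ r, 0 < r ∧ r < s ∧ singularSubspace T r = singularSubspace T s := by
  have hfin := finite_setOf_singularEigenspace_ne_bot hT (half_pos hs)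
  have hev : ∀ᶠ r in 𝓝[<] s, ∀ t ∈ {t : ℝ | s / 2 ≤ t ∧ singularEigenspace T t ≠ ⊥}, r ≤ t → s ≤ t := by
    rw [hfin.eventually_all]
    rintro t -
    by_cases hst : s ≤ t
    · exact Eventually.of_forall fun _ _ => hst
    · push Not at hst
      filter_upwards [Ioo_mem_nhdsLT hst] with r hr h
      exact absurd h hr.1.not_ge
  obtain ⟨r, hr, hr2⟩ := (hev.and (Ioo_mem_nhdsLT (half_lt_self hs))).exists
  refine ⟨r, (half_pos hs).trans hr2.1, hr2.2, le_antisymm ?_ (singularSubspace_antitone T hr2.2.le)⟩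
  exact singularSubspace_le_of_forall fun t h1 h2 =>
    singularEigenspace_le T (hr t ⟨hr2.1.le.trans h1, h2⟩ h1)

theorem exists_gt_forall_singularEigenspace_eq_bot {T : E →L[ℂ] E} (hT : IsCompactOperator T)
    {s : ℝ} (hs : 0 < s) :
    ∃ r, s < r ∧ ∀ t, s < t → t < r → singularEigenspace T t = ⊥ := by
  have hfin := finite_setOf_singularEigenspace_ne_bot hT hs
  have hev : ∀ᶠ r in 𝓝[>] s, ∀ t ∈ {t : ℝ | s ≤ t ∧ singularEigenspace T t ≠ ⊥}, t < r → t ≤ s := by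
    rw [hfin.eventually_all]
    rintro t -
    by_cases hst : t ≤ s
    · exact Eventually.of_forall fun _ _ => hst
    · push Not at hst
      filter_upwards [Ioo_mem_nhdsGT hst] with r hr h
      exact absurd h hr.2.not_gt
  obtain ⟨r, hr, hr2⟩ := (hev.and self_mem_nhdsWithin).exists
  refine ⟨r, hr2, fun t h1 h2 => ?_⟩
  by_contra h
  exact (hr t ⟨h1.le, h⟩ h2).not_gt h1

theorem le_norm_of_singularSubspace_ne_bot {T : E →L[ℂ] E} {s : ℝ} (hs : 0 < s)
    (h : singularSubspace T s ≠ ⊥) : s ≤ ‖T‖ := by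
  obtain ⟨x, hx, hx0⟩ := Submodule.exists_mem_ne_zero_of_ne_bot h
  have := (norm_le_of_mem_singularSubspace T hs.le hx).trans (T.le_opNorm x)
  exact le_of_mul_le_mul_right this (norm_pos_iff.2 hx0)

theorem singularNumber_nonneg (T : E →L[ℂ] E) (k : ℕ) : 0 ≤ singularNumber T k :=
  Real.sSup_nonneg fun _ h => h.1.le

/-- This turns the supremum into a count of dimensions; indices start at `0`, hence the strict
inequality. -/
theorem le_singularNumber_iff {T : E →L[ℂ] E} (hT : IsCompactOperator T) {s : ℝ} (hs : 0 < s)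
    (k : ℕ) : s ≤ singularNumber T k ↔ k < Module.finrank ℂ (singularSubspace T s) := by
  have hrank : ∀ r, 0 < r → ((((k + 1 : ℕ) : Cardinal) ≤ Module.rank ℂ (singularSubspace T r)) ↔
      k < Module.finrank ℂ (singularSubspace T r)) := by
    intro r hr
    have := finiteDimensional_singularSubspace hT hr
    rw [← Module.finrank_eq_rank, Nat.cast_le, Nat.succ_le_iff]
  constructor
  · intro h
    obtain ⟨r, hr0, hrs, hr⟩ := exists_lt_singularSubspace_eq hT hs
    -- On the empty set `sSup` is `0`, which is incompatible with `0 < s ≤ singularNumber T k`.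
    have hne : {s : ℝ | 0 < s ∧
        ((k + 1 : ℕ) : Cardinal) ≤ Module.rank ℂ (singularSubspace T s)}.Nonempty := by
      by_contra hne
      rw [Set.not_nonempty_iff_eq_empty] at hne
      rw [singularNumber, hne, Real.sSup_empty] at h
      exact h.not_gt hs
    obtain ⟨r', ⟨hr'0, hr'⟩, hrr'⟩ := exists_lt_of_lt_csSup hne (hrs.trans_le h)
    rw [hrank r' hr'0] at hr'
    rw [← hr]
    have := finiteDimensional_singularSubspace hT hr0
    exact hr'.trans_le (Submodule.finrank_mono (singularSubspace_antitone T hrr'.le))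
  · intro h
    refine le_csSup ⟨‖T‖, ?_⟩ ⟨hs, (hrank s hs).2 h⟩
    rintro r ⟨hr0, hr⟩
    refine le_norm_of_singularSubspace_ne_bot hr0 fun hb => ?_
    rw [hrank r hr0, hb, finrank_bot] at hr
    exact Nat.not_lt_zero _ hr

theorem encard_setOf_singularNumber_eq {T : E →L[ℂ] E} (hT : IsCompactOperator T) {s : ℝ}
    (hs : 0 < s) : {k | singularNumber T k = s}.encard =
      Module.finrank ℂ (singularEigenspace T s) := by
  obtain ⟨r, hsr, hr⟩ := exists_gt_forall_singularEigenspace_eq_bot hT hs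
  -- No singular value lies strictly between `s` and `r`, so the indices with value exactly `s` run
  -- from `dim (singularSubspace T r)` up to, but excluding, `dim (singularSubspace T s)`.
  have hgt : ∀ k, s < singularNumber T k ↔ r ≤ singularNumber T k := by
    intro k
    refine ⟨fun h => ?_, fun h => hsr.trans_le h⟩
    rw [le_singularNumber_iff hT (hs.trans hsr)]
    rcases le_or_gt r (singularNumber T k) with h' | h'
    · exact (le_singularNumber_iff hT (hs.trans hsr) k).1 h'
    · refine ((le_singularNumber_iff hT (hs.trans h) k).1 le_rfl).trans_le ?_
      have := finiteDimensional_singularSubspace hT (hs.trans hsr)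
      refine Submodule.finrank_mono (singularSubspace_le_of_forall fun t ht hb => ?_)
      refine singularEigenspace_le T ?_
      by_contra hlt
      exact hb (hr t (h.trans_le ht) (not_le.1 hlt))
  have hset : {k | singularNumber T k = s} = Set.Ico (Module.finrank ℂ (singularSubspace T r))
      (Module.finrank ℂ (singularSubspace T s)) := by
    ext k
    rw [Set.mem_ofPred_eq, Set.mem_Ico, ← le_singularNumber_iff hT hs, ← not_lt,
      ← le_singularNumber_iff hT (hs.trans hsr), ← hgt, not_lt, le_antisymm_iff]
  have hsup : singularSubspace T s = singularEigenspace T s ⊔ singularSubspace T r := by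
    refine le_antisymm (singularSubspace_le_of_forall fun t ht hb => ?_)
      (sup_le (singularEigenspace_le T le_rfl) (singularSubspace_antitone T hsr.le))
    rcases ht.eq_or_lt with rfl | h
    · exact le_sup_left
    · refine (singularEigenspace_le T ?_).trans le_sup_right
      by_contra hlt
      exact hb (hr t h (not_le.1 hlt))
  have hdisj : singularEigenspace T s ⊓ singularSubspace T r = ⊥ := by
    have hI := (singularEigenspace_orthogonalFamily_of_le T hs.le).independent ⟨s, le_rfl⟩
    refine (hI.mono_right (singularSubspace_le_of_forall fun t ht _ => ?_)).eq_bot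
    exact le_iSup₂ (f := fun (j : {t : ℝ // s ≤ t}) (_ : j ≠ ⟨s, le_rfl⟩) =>
      singularEigenspace T j) ⟨t, hsr.le.trans ht⟩
      fun h => (hsr.trans_le ht).ne' (congrArg Subtype.val h)
  have := finiteDimensional_singularSubspace hT (hs.trans hsr)
  have := finiteDimensional_singularSubspace hT hs
  have : FiniteDimensional ℂ (singularEigenspace T s) :=
    Submodule.finiteDimensional_of_le (singularEigenspace_le T le_rfl)
  have hdim := Submodule.finrank_sup_add_finrank_inf_eq (singularEigenspace T s)
    (singularSubspace T r)
  rw [hdisj, finrank_bot, ← hsup] at hdim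
  rw [hset, ← Finset.coe_Ico, Set.encard_coe_eq_coe_finsetCard, Nat.card_Ico]
  congr 1
  omega

end SingularNumbers

/-! ### Finite-dimensional spaces stable under mutually annihilating idempotents -/

section OrthogonalDecomposition

variable {R M ι : Type*} [DivisionRing R] [AddCommGroup M] [Module R M] {P : ι → M →ₗ[R] M}
  {V : Submodule R M}

theorem finite_setOf_map_ne_bot [FiniteDimensional R V]
    (hVP : ∀ i, V.map (P i) ≤ V) (hidem : ∀ i x, P i (P i x) = P i x)
    (horth : ∀ i j, i ≠ j → ∀ x, P i (P j x) = 0) : {i | V.map (P i) ≠ ⊥}.Finite := by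
  have hex : ∀ i : {i | V.map (P i) ≠ ⊥}, ∃ x ∈ V, P i.1 x ≠ 0 := by
    intro i
    obtain ⟨_, ⟨x, hx, rfl⟩, hx0⟩ := (V.map (P i)).exists_mem_ne_zero_of_ne_bot i.2
    exact ⟨x, hx, hx0⟩
  choose x hx hx0 using hex
  -- Applying `P i` to a linear relation isolates its `i`-th coefficient.
  have hli : LinearIndependent R fun i => P i.1 (x i) := by
    rw [linearIndependent_iff']
    intro s g hg i hi
    have h := congrArg (P i.1) hg
    rw [map_sum, map_zero, Finset.sum_eq_single i] at h
    · rw [map_smul, hidem] at h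
      exact (smul_eq_zero.1 h).resolve_right (hx0 i)
    · intro j _ hj
      rw [map_smul, horth _ _ (fun h => hj (Subtype.ext h.symm)), smul_zero]
    · exact fun h => absurd hi h
  have hli' : LinearIndependent R
      fun i => (⟨P i.1 (x i), hVP i.1 (Submodule.mem_map_of_mem (hx i))⟩ : V) :=
    LinearIndependent.of_comp V.subtype hli
  have := hli'.finite
  exact Set.toFinite _

/-- The map `x ↦ (P i x)` identifies `V` with the product of its nonzero images: injective by `hV`,
surjective because summing the components inverts it. -/
theorem finrank_eq_sum_finrank_map [FiniteDimensional R V]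
    (hVP : ∀ i, V.map (P i) ≤ V) (hidem : ∀ i x, P i (P i x) = P i x)
    (horth : ∀ i j, i ≠ j → ∀ x, P i (P j x) = 0) (hV : ∀ x ∈ V, (∀ i, P i x = 0) → x = 0)
    (F : Finset ι) (hF : ∀ i, V.map (P i) ≠ ⊥ → i ∈ F) :
    Module.finrank R V = ∑ i ∈ F, Module.finrank R (V.map (P i)) := by
  classical
  let Φ : V →ₗ[R] ∀ i : F, V.map (P i) :=
    LinearMap.pi fun i => (P i).restrict fun x hx => Submodule.mem_map_of_mem hx
  have hΦ : ∀ x i, (Φ x i : M) = P i x := fun _ _ => rfl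
  have hbij : Function.Bijective Φ := by
    constructor
    · rw [← LinearMap.ker_eq_bot, LinearMap.ker_eq_bot']
      intro x hx
      refine Subtype.ext (hV x x.2 fun i => ?_)
      by_cases hi : i ∈ F
      · rw [← hΦ x ⟨i, hi⟩, hx]; rfl
      · have hb : V.map (P i) = ⊥ := by
          by_contra h
          exact hi (hF i h)
        exact (Submodule.mem_bot R).1 (hb ▸ Submodule.mem_map_of_mem x.2)
    · intro y
      refine ⟨⟨∑ i, (y i : M), V.sum_mem fun i _ => hVP i (y i).2⟩, ?_⟩
      funext i
      refine Subtype.ext ?_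
      rw [hΦ]
      simp only [map_sum]
      rw [Finset.sum_eq_single i]
      · obtain ⟨z, -, hz⟩ := (y i).2
        rw [← hz, hidem]
      · intro j _ hj
        obtain ⟨z, -, hz⟩ := (y j).2
        rw [← hz, horth _ _ fun h => hj (Subtype.ext h.symm)]
      · simp
  have hfin : ∀ i : F, FiniteDimensional R (V.map (P i)) := fun i => inferInstance
  rw [(LinearEquiv.ofBijective Φ hbij).finrank_eq, Module.finrank_pi_fintype,
    Finset.sum_coe_sort F fun i => Module.finrank R (V.map (P i))]

end OrthogonalDecomposition

/-! ### Spectral and Gram matrix arguments in Hilbert space -/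

section Hilbert

variable {E G : Type*} [NormedAddCommGroup E] [InnerProductSpace ℂ E] [CompleteSpace E]
  [NormedAddCommGroup G] [InnerProductSpace ℂ G] [CompleteSpace G]

theorem eq_zero_of_forall_singularEigenspace_eq_bot {T : E →L[ℂ] E} (hT : IsCompactOperator T)
    (h : ∀ s, 0 < s → singularEigenspace T s = ⊥) : T = 0 := by
  have hsym := isSymmetric_adjoint_comp_self T
  -- By the spectral theorem, a compact self-adjoint operator without nonzero eigenvalues vanishes.
  -- Eigenvalues of `T* T` are real and nonnegative, so a nonzero one is the square of some `s > 0`.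
  have hD : (ContinuousLinearMap.adjoint T ∘L T : E →L[ℂ] E) = 0 := by
    refine (ContinuousLinearMap.eq_zero_of_forall_hasEigenvalue_eq_zero
      (hT.clm_comp (ContinuousLinearMap.adjoint T)) hsym).1 fun μ hμ => ?_
    obtain ⟨r, rfl⟩ : ∃ r : ℝ, (r : ℂ) = μ :=
      Complex.conj_eq_iff_real.1 (hsym.conj_eigenvalue_eq_self hμ) |>.imp fun _ h => h.symm
    have hr : 0 ≤ r := eigenvalue_nonneg_of_nonneg hμ fun x => by
      rw [ContinuousLinearMap.coe_coe, ContinuousLinearMap.comp_apply,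
        ContinuousLinearMap.adjoint_inner_right]
      exact inner_self_nonneg
    by_contra hr0
    have hr' : 0 < r := lt_of_le_of_ne hr fun h => hr0 (by rw [← h]; rfl)
    have := h (√r) (Real.sqrt_pos.2 hr')
    rw [singularEigenspace, Real.sq_sqrt hr] at this
    exact hμ this
  ext x
  have hx : ‖T x‖ ^ 2 = 0 := by
    rw [← inner_self_eq_norm_sq (𝕜 := ℂ) (T x), ← ContinuousLinearMap.adjoint_inner_left]
    have := congrArg (fun S : E →L[ℂ] E => S x) hD
    simp only [ContinuousLinearMap.comp_apply, zero_apply] at this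
    rw [this, inner_zero_left, map_zero]
  simpa using hx

theorem singularEigenspace_zero {s : ℝ} (hs : 0 < s) :
    singularEigenspace (0 : E →L[ℂ] E) s = ⊥ := by
  rw [Submodule.eq_bot_iff]
  intro x hx
  rw [mem_singularEigenspace] at hx
  simpa [hs.ne', eq_comm (a := (0 : E))] using hx

omit [CompleteSpace E] in
theorem denseRange_linearCombination {e : ℕ → E}
    (he : (Submodule.span ℂ (Set.range e)).topologicalClosure = ⊤) :
    DenseRange (Finsupp.linearCombination ℂ e) := by
  rw [DenseRange, ← LinearMap.coe_range, Finsupp.range_linearCombination,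
    Submodule.dense_iff_topologicalClosure_eq_top]
  exact he

-- Equal Gram matrices make linear combinations of `e` and of `f` equal in norm, so `e n ↦ f n` is
-- well defined on a dense subspace and extends by continuity.
omit [CompleteSpace E] in
theorem exists_linearIsometry_of_inner_eq {e : ℕ → E} {f : ℕ → G}
    (he : (Submodule.span ℂ (Set.range e)).topologicalClosure = ⊤)
    (h : ∀ n m, inner ℂ (f n) (f m) = inner ℂ (e n) (e m)) :
    ∃ U : E →ₗᵢ[ℂ] G, ∀ n, U (e n) = f n := by
  set a := Finsupp.linearCombination ℂ e
  set b := Finsupp.linearCombination ℂ f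
  have hd : DenseRange a := denseRange_linearCombination he
  have hn : ∀ c, ‖b c‖ = ‖a c‖ := by
    intro c
    have h1 : inner ℂ (b c) (b c) = inner ℂ (a c) (a c) := by
      simp only [a, b, Finsupp.linearCombination_apply, Finsupp.sum, sum_inner, inner_sum,
        inner_smul_left, inner_smul_right, h]
    rw [inner_self_eq_norm_sq_to_K, inner_self_eq_norm_sq_to_K] at h1
    have h2 : ‖b c‖ ^ 2 = ‖a c‖ ^ 2 := by exact_mod_cast h1
    exact (sq_eq_sq₀ (norm_nonneg _) (norm_nonneg _)).1 h2
  have hb : ∃ C, ∀ x, ‖b x‖ ≤ C * ‖a x‖ := ⟨1, fun x => by rw [one_mul, hn]⟩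
  have hU : ∀ c, b.extendOfNorm a (a c) = b c := LinearMap.extendOfNorm_eq hd hb
  refine ⟨⟨(b.extendOfNorm a : E →ₗ[ℂ] G), ?_⟩, fun n => ?_⟩
  · refine hd.induction ?_ (isClosed_eq (by fun_prop) (by fun_prop))
    rintro _ ⟨c, rfl⟩
    simp only [ContinuousLinearMap.coe_coe, hU, hn]
  · have := hU (Finsupp.single n 1)
    simpa [a, b] using this

omit [CompleteSpace E] in
theorem eq_of_inner_eq_of_total {e : ℕ → E} {B C : E →L[ℂ] E}
    (he : (Submodule.span ℂ (Set.range e)).topologicalClosure = ⊤)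
    (h : ∀ n m, inner ℂ (e n) (B (e m)) = inner ℂ (e n) (C (e m))) : B = C := by
  have hd : Dense (Submodule.span ℂ (Set.range e) : Set E) :=
    Submodule.dense_iff_topologicalClosure_eq_top.2 he
  refine ContinuousLinearMap.ext_on hd ?_
  rintro _ ⟨m, rfl⟩
  refine hd.eq_of_inner_right (𝕜 := ℂ) fun v hv => ?_
  induction hv using Submodule.span_induction with
  | mem x hx => obtain ⟨n, rfl⟩ := hx; exact h n m
  | zero => simp
  | add x y _ _ hx hy => rw [inner_add_left, inner_add_left, hx, hy]
  | smul c x _ hx => rw [inner_smul_left, inner_smul_left, hx]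

/-- The matrix coefficients only determine the compression, `U* A U = T`. Invariance of the range of
`U` under `A` upgrades this to `A U = U T`. -/
theorem intertwines_of_inner_eq {e : ℕ → E} {T : E →L[ℂ] E} {A : G →L[ℂ] G} {U : E →ₗᵢ[ℂ] G}
    (he : (Submodule.span ℂ (Set.range e)).topologicalClosure = ⊤)
    (hA : ∀ x, ∃ y, A (U x) = U y)
    (h : ∀ n m, inner ℂ (U (e n)) (A (U (e m))) = inner ℂ (e n) (T (e m))) (x : E) :
    A (U x) = U (T x) := by
  have hT : ContinuousLinearMap.adjoint U.toContinuousLinearMap ∘L A ∘L U.toContinuousLinearMap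
      = T := by
    refine eq_of_inner_eq_of_total he fun n m => ?_
    rw [← h]
    simp [ContinuousLinearMap.adjoint_inner_right]
  obtain ⟨y, hy⟩ := hA x
  rw [hy]
  congr 1
  rw [← hT]
  refine ext_inner_left ℂ fun z => ?_
  simp [ContinuousLinearMap.adjoint_inner_right, hy]

theorem finrank_singularEigenspace_inf_range {T : E →L[ℂ] E} {A : G →L[ℂ] G} {U : E →ₗᵢ[ℂ] G}
    (h : ∀ x, A (U x) = U (T x))
    (h' : ∀ x, ContinuousLinearMap.adjoint A (U x) = U (ContinuousLinearMap.adjoint T x)) (s : ℝ) :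
    Module.finrank ℂ (singularEigenspace A s ⊓ LinearMap.range U.toLinearMap : Submodule ℂ G) =
      Module.finrank ℂ (singularEigenspace T s) := by
  have : singularEigenspace A s ⊓ LinearMap.range U.toLinearMap =
      (singularEigenspace T s).map U.toLinearMap := by
    ext y
    simp only [Submodule.mem_inf, LinearMap.mem_range, Submodule.mem_map, mem_singularEigenspace]
    constructor
    · rintro ⟨hy, x, rfl⟩
      refine ⟨x, U.injective ?_, rfl⟩
      rw [← h', ← h, map_smul]
      exact hy
    · rintro ⟨x, hx, rfl⟩
      refine ⟨?_, x, rfl⟩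
      rw [LinearIsometry.coe_toLinearMap, h, h', hx, map_smul]
  rw [this]
  exact (LinearEquiv.finrank_eq (Submodule.equivMapOfInjective U.toLinearMap U.injective _)).symm

end Hilbert

/-! ### Atoms of finite measure -/

section Atoms

variable {Λ : Type u} [MeasurableSpace Λ]

/-- An atom of finite measure. -/
structure IsFiniteAtom (μ : Measure Λ) (B : Set Λ) : Prop where
  measurableSet : MeasurableSet B
  ne_zero : μ B ≠ 0
  ne_top : μ B ≠ ∞
  inter_or_diff : ∀ C, MeasurableSet C → μ (B ∩ C) = 0 ∨ μ (B \ C) = 0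

variable {μ : Measure Λ} {B C : Set Λ}

/-- The preimage of each Borel set is null or conull in `B`, and countably many Borel sets separate
the points of `ℂ`. -/
theorem IsFiniteAtom.exists_ae_eq_const (hB : IsFiniteAtom μ B) {f : Λ → ℂ} (hf : Measurable f) :
    ∃ c, ∀ᵐ i ∂μ, i ∈ B → f i = c := by
  have h := exists_eventuallyEq_const_of_forall_separating (l := ae (μ.restrict B)) (f := f)
    MeasurableSet fun U hU => ?_
  · obtain ⟨c, hc⟩ := h
    exact ⟨c, (ae_restrict_iff' hB.measurableSet).1 hc⟩
  · rcases hB.inter_or_diff _ (hf hU) with h | h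
    · right
      rw [ae_restrict_iff' hB.measurableSet, ae_iff]
      convert h using 2
      ext i
      simp
    · left
      rw [ae_restrict_iff' hB.measurableSet, ae_iff]
      convert h using 2
      ext i
      simp

theorem IsFiniteAtom.ae_eq_or_inter (hB : IsFiniteAtom μ B) (hC : IsFiniteAtom μ C) :
    B =ᵐ[μ] C ∨ μ (B ∩ C) = 0 := by
  rcases hB.inter_or_diff C hC.measurableSet with h1 | h1
  · exact Or.inr h1
  rcases hC.inter_or_diff B hB.measurableSet with h2 | h2
  · exact Or.inr (by rwa [Set.inter_comm])
  · exact Or.inl (ae_eq_set.2 ⟨h1, h2⟩)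

end Atoms

/-! ### Diagonal projections and localization on atoms -/

section Restriction

variable {Λ : Type u} [MeasurableSpace Λ] {H : Λ → Type v}
  [∀ i, NormedAddCommGroup (H i)] [∀ i, InnerProductSpace ℂ (H i)]
  {μ : Measure Λ} {F : HilbertField Λ H} {B C : Set Λ}

open Classical in
/-- The section that agrees with `x` on `B` and vanishes off `B`. -/
noncomputable def cutoff (B : Set Λ) (x : ∀ i, H i) : ∀ i, H i := fun i => if i ∈ B then x i else 0

omit [MeasurableSpace Λ] [∀ i, InnerProductSpace ℂ (H i)] in
theorem cutoff_of_mem {x : ∀ i, H i} {i : Λ} (hi : i ∈ B) : cutoff B x i = x i := if_pos hi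

omit [MeasurableSpace Λ] [∀ i, InnerProductSpace ℂ (H i)] in
theorem cutoff_of_notMem {x : ∀ i, H i} {i : Λ} (hi : i ∉ B) : cutoff B x i = 0 := if_neg hi

theorem cutoff_mem_sections (hB : MeasurableSet B) {x : ∀ i, H i} (hx : x ∈ F.sections) :
    cutoff B x ∈ F.sections := by
  refine F.mem_of_measurable_inner _ fun y hy => ?_
  convert (F.measurable_inner hy hx).indicator hB using 1
  ext i
  by_cases hi : i ∈ B <;> simp [cutoff, hi]

namespace HilbertField.L2Section

/-- Multiplication of a square-integrable section by the indicator function of `B`. -/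
noncomputable def restrict (hB : MeasurableSet B) (x : L2Section μ F) : L2Section μ F :=
  ⟨cutoff B x, cutoff_mem_sections hB x.2.1, x.2.2.mono
    (F.measurable_norm _ (cutoff_mem_sections hB x.2.1)).aestronglyMeasurable
    (Eventually.of_forall fun i => by by_cases hi : i ∈ B <;> simp [cutoff, hi])⟩

theorem restrict_apply_of_mem (hB : MeasurableSet B) (x : L2Section μ F) {i : Λ} (hi : i ∈ B) :
    restrict hB x i = x i := cutoff_of_mem hi

theorem restrict_apply_of_notMem (hB : MeasurableSet B) (x : L2Section μ F) {i : Λ} (hi : i ∉ B) :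
    restrict hB x i = 0 := cutoff_of_notMem hi

theorem norm_restrict_le (hB : MeasurableSet B) (x : L2Section μ F) : ‖restrict hB x‖ ≤ ‖x‖ := by
  refine abs_le_of_sq_le_sq' ?_ (norm_nonneg _) |>.2
  rw [norm_sq_eq, norm_sq_eq]
  refine integral_mono (restrict hB x).2.2.integrable_sq x.2.2.integrable_sq fun i => ?_
  by_cases hi : i ∈ B
  · simp only [restrict_apply_of_mem hB x hi, le_refl]
  · simp only [restrict_apply_of_notMem hB x hi, norm_zero, ne_eq, OfNat.ofNat_ne_zero,
      not_false_eq_true, zero_pow]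
    positivity

/-- `restrict` as a continuous linear map. -/
noncomputable def restrictL (hB : MeasurableSet B) : L2Section μ F →L[ℂ] L2Section μ F :=
  LinearMap.mkContinuous
    { toFun := restrict hB
      map_add' := fun x y => by
        refine Subtype.ext (funext fun i => ?_)
        change restrict hB (x + y) i = restrict hB x i + restrict hB y i
        by_cases hi : i ∈ B
        · simp only [restrict_apply_of_mem hB _ hi, add_apply]
        · simp only [restrict_apply_of_notMem hB _ hi, add_zero]
      map_smul' := fun c x => by
        refine Subtype.ext (funext fun i => ?_)
        change restrict hB (c • x) i = c • restrict hB x i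
        by_cases hi : i ∈ B
        · simp only [restrict_apply_of_mem hB _ hi, smul_apply]
        · simp only [restrict_apply_of_notMem hB _ hi, smul_zero] } 1
    fun x => by rw [one_mul]; exact norm_restrict_le hB x

/-- A square-integrable section that is not almost everywhere zero on `C` vanishes nowhere on some
subset of `C` of positive finite measure. -/
theorem exists_subset_forall_ne_zero (hC : MeasurableSet C) {x : L2Section μ F}
    (hx0 : ¬ ∀ᵐ i ∂μ, i ∈ C → x i = 0) :
    ∃ N ⊆ C, MeasurableSet N ∧ μ N ≠ 0 ∧ μ N ≠ ∞ ∧ ∀ i ∈ N, x i ≠ 0 := by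
  have hxm : Measurable fun i => ‖x i‖ := F.measurable_norm _ x.2.1
  let N : ℕ → Set Λ := fun k => C ∩ {i | 1 / ((k : ℝ) + 1) ≤ ‖x i‖}
  obtain ⟨k, hk⟩ : ∃ k, μ (N k) ≠ 0 := by
    by_contra! h
    refine hx0 ?_
    filter_upwards [measure_eq_zero_iff_ae_notMem.1 (measure_iUnion_null h)] with i hi hiC
    by_contra hxi
    obtain ⟨k, hk⟩ := exists_nat_one_div_lt (norm_pos_iff.2 hxi)
    exact hi (Set.mem_iUnion.2 ⟨k, hiC, hk.le⟩)
  refine ⟨N k, Set.inter_subset_left, hC.inter (measurableSet_le measurable_const hxm), hk, ?_, ?_⟩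
  · have := x.2.2.meas_ge_lt_top' (by norm_num) (by norm_num)
      (ε := ENNReal.ofReal (1 / ((k : ℝ) + 1)))
      (by rw [ne_eq, ENNReal.ofReal_eq_zero, not_le]; exact Nat.one_div_pos_of_nat)
    refine ne_top_of_le_ne_top this.ne (measure_mono fun i hi => ?_)
    have h1 : 1 / ((k : ℝ) + 1) ≤ ‖x i‖ := hi.2
    change _ ≤ ‖‖x i‖‖ₑ
    rw [enorm_norm, ← ofReal_norm]
    exact ENNReal.ofReal_le_ofReal h1
  · intro i hi h0
    have h1 : 1 / ((k : ℝ) + 1) ≤ ‖x i‖ := hi.2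
    rw [h0, norm_zero] at h1
    exact h1.not_gt Nat.one_div_pos_of_nat

end HilbertField.L2Section

namespace DirectIntegral

open HilbertField.L2Section

theorem mk_surjective : Function.Surjective (mk : HilbertField.L2Section μ F → DirectIntegral μ F) :=
  SeparationQuotient.surjective_mk

theorem mk_eq_zero_iff (x : HilbertField.L2Section μ F) :
    (mk x : DirectIntegral μ F) = 0 ↔ ∀ᵐ i ∂μ, x i = 0 :=
  mk_eq_mk_iff x 0

theorem inner_mk (x y : HilbertField.L2Section μ F) :
    inner ℂ (mk x : DirectIntegral μ F) (mk y) = ∫ i, inner ℂ (x i) (y i) ∂μ := by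
  rw [← inner_def]
  exact SeparationQuotient.inner_mk_mk x y

/-- The diagonal projection of the direct integral given by the indicator function of `B`. -/
noncomputable def proj (μ : Measure Λ) (F : HilbertField Λ H) (hB : MeasurableSet B) :
    DirectIntegral μ F →L[ℂ] DirectIntegral μ F :=
  SeparationQuotient.liftCLM (SeparationQuotient.mkCLM ℂ _ ∘L restrictL hB)
    fun _ _ h => (h.map (SeparationQuotient.mkCLM ℂ _ ∘L restrictL hB).continuous).eq

theorem proj_mk (hB : MeasurableSet B) (x : HilbertField.L2Section μ F) :
    proj μ F hB (mk x) = mk (restrict hB x) := rfl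

theorem proj_mk_eq_zero_iff (hB : MeasurableSet B) (x : HilbertField.L2Section μ F) :
    proj μ F hB (mk x) = 0 ↔ ∀ᵐ i ∂μ, i ∈ B → x i = 0 := by
  rw [proj_mk, mk_eq_zero_iff]
  refine eventually_congr (Eventually.of_forall fun i => ?_)
  by_cases hi : i ∈ B
  · simp [restrict_apply_of_mem hB x hi, hi]
  · simp [restrict_apply_of_notMem hB x hi, hi]

theorem proj_proj (hB : MeasurableSet B) (hC : MeasurableSet C) (z : DirectIntegral μ F) :
    proj μ F hB (proj μ F hC z) = proj μ F (hB.inter hC) z := by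
  obtain ⟨x, rfl⟩ := mk_surjective z
  rw [proj_mk, proj_mk, proj_mk, mk_eq_mk_iff]
  refine Eventually.of_forall fun i => ?_
  by_cases hi : i ∈ B <;> by_cases hj : i ∈ C <;>
    simp [restrict, cutoff, hi, hj]

theorem proj_congr (hB : MeasurableSet B) (hC : MeasurableSet C) (h : B =ᵐ[μ] C)
    (z : DirectIntegral μ F) : proj μ F hB z = proj μ F hC z := by
  obtain ⟨x, rfl⟩ := mk_surjective z
  rw [proj_mk, proj_mk, mk_eq_mk_iff]
  filter_upwards [h.mem_iff] with i hi
  by_cases hj : i ∈ C <;> simp [restrict, cutoff, hi, hj]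

theorem proj_eq_zero (hB : MeasurableSet B) (h : μ B = 0) (z : DirectIntegral μ F) :
    proj μ F hB z = 0 := by
  obtain ⟨x, rfl⟩ := mk_surjective z
  rw [proj_mk_eq_zero_iff]
  filter_upwards [measure_eq_zero_iff_ae_notMem.1 h] with i hi hi'
  exact absurd hi' hi

theorem proj_comm (hB : MeasurableSet B) (hC : MeasurableSet C) (z : DirectIntegral μ F) :
    proj μ F hB (proj μ F hC z) = proj μ F hC (proj μ F hB z) := by
  rw [proj_proj, proj_proj]
  exact proj_congr _ _ (.of_eq (Set.inter_comm B C)) z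

theorem proj_univ (z : DirectIntegral μ F) : proj μ F MeasurableSet.univ z = z := by
  obtain ⟨x, rfl⟩ := mk_surjective z
  rw [proj_mk, mk_eq_mk_iff]
  exact Eventually.of_forall fun i => restrict_apply_of_mem _ _ (Set.mem_univ i)

theorem proj_idem (hB : MeasurableSet B) (z : DirectIntegral μ F) :
    proj μ F hB (proj μ F hB z) = proj μ F hB z := by
  rw [proj_proj]
  congr 1
  simp only [Set.inter_self]

theorem inner_proj_left (hB : MeasurableSet B) (z w : DirectIntegral μ F) :
    inner ℂ (proj μ F hB z) w = inner ℂ z (proj μ F hB w) := by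
  obtain ⟨x, rfl⟩ := mk_surjective z
  obtain ⟨y, rfl⟩ := mk_surjective w
  rw [proj_mk, proj_mk, inner_mk, inner_mk]
  congr 1
  ext i
  by_cases hi : i ∈ B
  · rw [restrict_apply_of_mem hB x hi, restrict_apply_of_mem hB y hi]
  · rw [restrict_apply_of_notMem hB x hi, restrict_apply_of_notMem hB y hi, inner_zero_left,
      inner_zero_right]

variable {A : DirectIntegral μ F →L[ℂ] DirectIntegral μ F} {a : ∀ i, H i →L[ℂ] H i}

theorem IsDirectIntegral.map_proj (hA : IsDirectIntegral A a) (hB : MeasurableSet B)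
    (z : DirectIntegral μ F) : A (proj μ F hB z) = proj μ F hB (A z) := by
  obtain ⟨x, rfl⟩ := mk_surjective z
  obtain ⟨y, hy⟩ := mk_surjective (A (mk x))
  obtain ⟨w, hw⟩ := mk_surjective (A (mk (restrict hB x)))
  rw [proj_mk, ← hy, ← hw, proj_mk, mk_eq_mk_iff]
  filter_upwards [hA _ _ hy.symm, hA _ _ hw.symm] with i h1 h2
  by_cases hi : i ∈ B
  · rw [h2, restrict_apply_of_mem hB _ hi, restrict_apply_of_mem hB _ hi, h1]
  · rw [h2, restrict_apply_of_notMem hB _ hi, restrict_apply_of_notMem hB _ hi, map_zero]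

variable [∀ i, CompleteSpace (H i)]

theorem IsDirectIntegral.adjoint_map_proj (hA : IsDirectIntegral A a) (hB : MeasurableSet B)
    (z : DirectIntegral μ F) :
    ContinuousLinearMap.adjoint A (proj μ F hB z) =
      proj μ F hB (ContinuousLinearMap.adjoint A z) := by
  refine ext_inner_right ℂ fun w => ?_
  rw [ContinuousLinearMap.adjoint_inner_left, inner_proj_left, inner_proj_left,
    ContinuousLinearMap.adjoint_inner_left, hA.map_proj]

theorem IsDirectIntegral.proj_mem_singularEigenspace (hA : IsDirectIntegral A a)
    (hB : MeasurableSet B) {s : ℝ} {z : DirectIntegral μ F} (hz : z ∈ singularEigenspace A s) :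
    proj μ F hB z ∈ singularEigenspace A s := by
  rw [mem_singularEigenspace] at hz ⊢
  rw [hA.map_proj, hA.adjoint_map_proj, hz, map_smul]

omit [∀ i, CompleteSpace (H i)] in
/-- A nonzero finite-dimensional space of sections that is stable under multiplication by
indicator functions does not vanish on some atom. -/
theorem exists_isFiniteAtom_of_proj_mem {V : Submodule ℂ (DirectIntegral μ F)}
    [FiniteDimensional ℂ V] (hV : V ≠ ⊥)
    (hproj : ∀ (B : Set Λ) (hB : MeasurableSet B), ∀ x ∈ V, proj μ F hB x ∈ V) :
    ∃ B, ∃ hB : IsFiniteAtom μ B, ∃ x ∈ V, proj μ F hB.measurableSet x ≠ 0 := by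
  classical
  let W : ∀ {C : Set Λ}, MeasurableSet C → Submodule ℂ (DirectIntegral μ F) := fun hC =>
    V.map (proj μ F hC : DirectIntegral μ F →ₗ[ℂ] DirectIntegral μ F)
  have hW : ∀ {C : Set Λ} (hC : MeasurableSet C), FiniteDimensional ℂ (W hC) := fun hC =>
    inferInstanceAs (FiniteDimensional ℂ (V.map _))
  -- `C` is chosen so that the image of `V` over `C` has the least nonzero dimension; a nonzero
  -- image inside it must then equal it.
  have hex : ∃ n, n ≠ 0 ∧ ∃ C, ∃ hC : MeasurableSet C, Module.finrank ℂ (W hC) = n := by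
    refine ⟨_, ?_, Set.univ, MeasurableSet.univ, rfl⟩
    have : W (MeasurableSet.univ (α := Λ)) = V := by
      ext z
      simp [W, proj_univ]
    rwa [this, ne_eq, Submodule.finrank_eq_zero]
  obtain ⟨hn0, C, hC, hCn⟩ := Nat.find_spec hex
  have hmin : ∀ {D : Set Λ} (hD : MeasurableSet D), W hD ≤ W hC → W hD ≠ ⊥ → W hD = W hC := by
    intro D hD hle hne
    have := hW hC
    have := hW hD
    refine Submodule.eq_of_le_of_finrank_le hle ?_
    rw [hCn]
    refine Nat.find_min' hex ⟨?_, D, hD, rfl⟩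
    rwa [ne_eq, Submodule.finrank_eq_zero]
  have hWle : ∀ {D : Set Λ} (hD : MeasurableSet D), W (hC.inter hD) ≤ W hC := by
    rintro D hD _ ⟨x, hx, rfl⟩
    refine ⟨proj μ F hD x, hproj D hD x hx, ?_⟩
    exact proj_proj hC hD x
  have hCne : W hC ≠ ⊥ := by
    have := hW hC
    rwa [ne_eq, ← Submodule.finrank_eq_zero (R := ℂ), hCn]
  -- If both halves of `C` carried something, both images would equal `W hC`, whose vectors would
  -- then be supported on two disjoint sets.
  have hsplit : ∀ {D : Set Λ} (hD : MeasurableSet D),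
      W (hC.inter hD) = ⊥ ∨ W (hC.inter hD.compl) = ⊥ := by
    intro D hD
    by_contra! h
    have h1 := hmin _ (hWle hD) h.1
    have h2 := hmin _ (hWle hD.compl) h.2
    refine hCne ((Submodule.eq_bot_iff _).2 fun w hw => ?_)
    obtain ⟨x, -, hx⟩ := h1 ▸ hw
    obtain ⟨y, -, hy⟩ := h2 ▸ hw
    rw [ContinuousLinearMap.coe_coe] at hx hy
    rw [← hx, ← proj_idem, hx, ← hy, proj_proj]
    refine proj_eq_zero _ ?_ y
    convert measure_empty (μ := μ)
    ext i
    simp only [Set.mem_inter_iff, Set.mem_compl_iff, Set.mem_empty_iff_false]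
    tauto
  obtain ⟨_, ⟨z, hz, rfl⟩, hz0⟩ := Submodule.exists_mem_ne_zero_of_ne_bot hCne
  obtain ⟨x, rfl⟩ := mk_surjective z
  have hx0 : ¬ ∀ᵐ i ∂μ, i ∈ C → x i = 0 := fun h => hz0 ((proj_mk_eq_zero_iff hC x).2 h)
  -- `C` itself need be neither of finite measure nor an atom, since fibres may be trivial. On `N`
  -- the section `x` has no zeros, so vanishing of an image over `C ∩ D` forces `N ∩ D` to be null.
  obtain ⟨N, hNC, hNm, hN0, hNt, hNx⟩ := exists_subset_forall_ne_zero hC hx0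
  have hvanish : ∀ {D : Set Λ} (hD : MeasurableSet D), W (hC.inter hD) = ⊥ → μ (N ∩ D) = 0 := by
    intro D hD h
    have hp : proj μ F (hC.inter hD) (mk x) = 0 :=
      (Submodule.mem_bot ℂ).1 (h ▸ Submodule.mem_map_of_mem hz)
    rw [proj_mk_eq_zero_iff] at hp
    rw [measure_eq_zero_iff_ae_notMem]
    filter_upwards [hp] with i hi hi'
    exact hNx i hi'.1 (hi ⟨hNC hi'.1, hi'.2⟩)
  refine ⟨N, ⟨hNm, hN0, hNt, fun D hD => (hsplit hD).imp (hvanish hD) (hvanish hD.compl)⟩,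
    mk x, hz, fun h => hN0 ?_⟩
  rw [proj_mk_eq_zero_iff] at h
  rw [measure_eq_zero_iff_ae_notMem]
  filter_upwards [h] with i hi hi'
  exact hNx i hi' (hi hi')

end DirectIntegral

end Restriction

/-! ### Identification of the fibre over an atom -/

section AtomFibre

variable {Λ : Type u} [MeasurableSpace Λ] {H : Λ → Type v}
  [∀ i, NormedAddCommGroup (H i)] [∀ i, InnerProductSpace ℂ (H i)]
  {μ : Measure Λ} {F : HilbertField Λ H} {B : Set Λ}

/-- A vector orthogonal to a total sequence vanishes. -/
theorem eq_zero_of_inner_eq_zero_of_total {E : Type*} [NormedAddCommGroup E]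
    [InnerProductSpace ℂ E] {e : ℕ → E}
    (he : (Submodule.span ℂ (Set.range e)).topologicalClosure = ⊤) {x : E}
    (hx : ∀ n, inner ℂ (e n) x = 0) : x = 0 := by
  have hd : Dense (Submodule.span ℂ (Set.range e) : Set E) :=
    Submodule.dense_iff_topologicalClosure_eq_top.2 he
  refine hd.eq_zero_of_inner_right (𝕜 := ℂ) fun v hv => ?_
  induction hv using Submodule.span_induction with
  | mem y hy => obtain ⟨n, rfl⟩ := hy; exact hx n
  | zero => simp
  | add y z _ _ hy hz => rw [inner_add_left, hy, hz, add_zero]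
  | smul c y _ hy => rw [inner_smul_left, hy, mul_zero]

theorem IsFiniteAtom.cutoff_mem_l2Submodule (hB : IsFiniteAtom μ B) {x : ∀ i, H i}
    (hx : x ∈ F.sections) : cutoff B x ∈ F.l2Submodule μ := by
  have hm := cutoff_mem_sections hB.measurableSet hx
  obtain ⟨c, hc⟩ := hB.exists_ae_eq_const
    (Complex.measurable_ofReal.comp (F.measurable_norm x hx))
  refine ⟨hm, (memLp_indicator_const 2 hB.measurableSet c (Or.inr hB.ne_top)).mono
    (F.measurable_norm _ hm).aestronglyMeasurable ?_⟩
  filter_upwards [hc] with i hi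
  by_cases hiB : i ∈ B
  · simp [cutoff, hiB, ← hi hiB]
  · simp [cutoff, hiB]

theorem integral_eq_of_ae_eq_const_on (hB : IsFiniteAtom μ B) {f : Λ → ℂ} {c : ℂ}
    (hf : ∀ᵐ i ∂μ, i ∈ B → f i = c) (hf' : ∀ i, i ∉ B → f i = 0) :
    ∫ i, f i ∂μ = ((μ B).toReal : ℂ) * c := by
  have : f =ᵐ[μ] B.indicator fun _ => c := by
    filter_upwards [hf] with i hi
    by_cases hiB : i ∈ B
    · rw [hi hiB, Set.indicator_of_mem hiB]
    · rw [hf' i hiB, Set.indicator_of_notMem hiB]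
  rw [integral_congr_ae this, integral_indicator_const _ hB.measurableSet, measureReal_def,
    Complex.real_smul]

namespace DirectIntegral

open HilbertField.L2Section

variable {A : DirectIntegral μ F →L[ℂ] DirectIntegral μ F} {a : ∀ i, H i →L[ℂ] H i}
  [∀ i, CompleteSpace (H i)]

/-- On an atom `B`, almost every fibre is isometric to the range of the projection `proj μ F hB`,
compatibly with `A` and its fibre. -/
theorem IsDirectIntegral.ae_exists_linearIsometry (hA : IsDirectIntegral A a)
    (hB : IsFiniteAtom μ B) : ∀ᵐ i ∂μ, i ∈ B → ∃ U : H i →ₗᵢ[ℂ] DirectIntegral μ F,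
      (∀ z, z ∈ LinearMap.range U.toLinearMap ↔ proj μ F hB.measurableSet z = z) ∧
      (∀ x, A (U x) = U (a i x)) ∧
      ∀ x, ContinuousLinearMap.adjoint A (U x) = U (ContinuousLinearMap.adjoint (a i) x) := by
  obtain ⟨e, heS, heT⟩ := F.exists_fundamental
  have hm0 : (μ B).toReal ≠ 0 := ENNReal.toReal_ne_zero.2 ⟨hB.ne_zero, hB.ne_top⟩
  have hmpos : 0 < (μ B).toReal := lt_of_le_of_ne ENNReal.toReal_nonneg hm0.symm
  let f : ℕ → HilbertField.L2Section μ F := fun n => ⟨cutoff B (e n),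
    hB.cutoff_mem_l2Submodule (heS n)⟩
  have hf : ∀ n i, i ∈ B → f n i = e n i := fun n i hi => cutoff_of_mem hi
  have hf' : ∀ n i, i ∉ B → f n i = 0 := fun n i hi => cutoff_of_notMem hi
  have hy : ∀ n, ∃ y : HilbertField.L2Section μ F, A (mk (f n)) = mk y := fun n =>
    (mk_surjective (A (mk (f n)))).imp fun _ h => h.symm
  choose y hy using hy
  have hc := fun n m => hB.exists_ae_eq_const (F.measurable_inner (heS n) (heS m))
  choose c hc using hc
  have hd := fun n m => hB.exists_ae_eq_const (F.measurable_inner (heS n) (y m).2.1)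
  choose d hd using hd
  have hya : ∀ n, ∀ᵐ i ∂μ, y n i = a i (f n i) := fun n => hA _ _ (hy n)
  -- A good point `i` realizes all the a.e. constants `c n m` and `d n m` at once; these are
  -- countably many conditions.
  filter_upwards [ae_all_iff.2 fun n => ae_all_iff.2 (hc n),
    ae_all_iff.2 fun n => ae_all_iff.2 (hd n), ae_all_iff.2 hya] with i hic hid hiy hi
  -- The cut-off sections have Gram matrix `μ B * c n m`; the factor `(μ B)^(-1/2)` normalizes it to
  -- that of `e n i`.
  let r : ℂ := ((√(μ B).toReal)⁻¹ : ℝ)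
  have hr : ∀ k : ℂ, star r * (r * (((μ B).toReal : ℂ) * k)) = k := by
    intro k
    have h1 : star r * (r * (((μ B).toReal : ℂ) * k)) =
        (((√(μ B).toReal)⁻¹ * (√(μ B).toReal)⁻¹ * (μ B).toReal : ℝ) : ℂ) * k := by
      simp only [r, Complex.star_def, Complex.conj_ofReal]
      push_cast
      ring
    rw [h1, ← mul_inv, Real.mul_self_sqrt hmpos.le, inv_mul_cancel₀ hm0, Complex.ofReal_one,
      one_mul]
  have hr0 : r ≠ 0 := by
    simpa [r] using (Real.sqrt_pos.2 hmpos).ne'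
  obtain ⟨U, hU⟩ := exists_linearIsometry_of_inner_eq (e := fun n => e n i)
    (f := fun n => r • (mk (f n) : DirectIntegral μ F)) (heT i) fun n m => by
      rw [inner_smul_left, inner_smul_right, inner_mk,
        integral_eq_of_ae_eq_const_on hB (c := c n m), hic n m hi]
      · exact hr _
      · filter_upwards [hc n m] with j hj hjB
        rw [hf n j hjB, hf m j hjB, hj hjB]
      · intro j hj
        rw [hf' n j hj, inner_zero_left]
  have hUp : ∀ x, proj μ F hB.measurableSet (U x) = U x := by
    have : proj μ F hB.measurableSet ∘L U.toContinuousLinearMap = U.toContinuousLinearMap := by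
      refine ContinuousLinearMap.ext_on (Submodule.dense_iff_topologicalClosure_eq_top.2 (heT i)) ?_
      rintro _ ⟨n, rfl⟩
      rw [ContinuousLinearMap.comp_apply, LinearIsometry.coe_toContinuousLinearMap]
      simp only [hU, map_smul]
      congr 1
      rw [proj_mk, mk_eq_mk_iff]
      refine Eventually.of_forall fun j => ?_
      by_cases hj : j ∈ B
      · exact restrict_apply_of_mem _ _ hj
      · rw [restrict_apply_of_notMem _ _ hj, hf' n j hj]
    exact fun x => congrArg (fun S : H i →L[ℂ] DirectIntegral μ F => S x) this
  have hrange : ∀ z, z ∈ LinearMap.range U.toLinearMap ↔ proj μ F hB.measurableSet z = z := by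
    intro z
    constructor
    · rintro ⟨x, rfl⟩
      exact hUp x
    intro hz
    have hcl : IsClosed (LinearMap.range U.toLinearMap : Set (DirectIntegral μ F)) := by
      rw [LinearMap.coe_range]
      exact U.isometry.isClosedEmbedding.isClosed_range
    have : CompleteSpace (LinearMap.range U.toLinearMap) := hcl.completeSpace_coe
    -- A section supported on `B` and orthogonal to the range has a.e. constant inner products with
    -- each `e n` on `B`, with integral zero. They vanish a.e., and totality in the fibres gives `w
    -- = 0`.
    obtain ⟨z', hz', w, hw, rfl⟩ :=
      Submodule.exists_add_mem_mem_orthogonal (K := LinearMap.range U.toLinearMap) z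
    have hz'p : proj μ F hB.measurableSet z' = z' := by
      obtain ⟨x, rfl⟩ := hz'
      exact hUp x
    have hwp : proj μ F hB.measurableSet w = w := by
      rw [map_add, hz'p] at hz
      exact add_left_cancel hz
    suffices hw0 : w = 0 by rwa [hw0, add_zero]
    obtain ⟨w, rfl⟩ := mk_surjective w
    rw [← hwp, proj_mk_eq_zero_iff]
    have hk : ∀ n, ∀ᵐ j ∂μ, j ∈ B → inner ℂ (e n j) (w j) = 0 := by
      intro n
      obtain ⟨k, hk⟩ := hB.exists_ae_eq_const (F.measurable_inner (heS n) w.2.1)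
      have h0 : inner ℂ (mk (f n) : DirectIntegral μ F) (mk w) = 0 := by
        have := (Submodule.mem_orthogonal _ _).1 hw (U (e n i)) ⟨e n i, rfl⟩
        rw [hU, inner_smul_left] at this
        exact (mul_eq_zero.1 this).resolve_left (star_ne_zero.2 hr0)
      rw [inner_mk, integral_eq_of_ae_eq_const_on hB (c := k)] at h0
      · have hk0 : k = 0 := (mul_eq_zero.1 h0).resolve_left (by exact_mod_cast hm0)
        rwa [hk0] at hk
      · filter_upwards [hk] with j hj hjB
        rw [hf n j hjB, hj hjB]
      · intro j hj
        rw [hf' n j hj, inner_zero_left]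
    filter_upwards [ae_all_iff.2 hk] with j hj hjB
    exact eq_zero_of_inner_eq_zero_of_total (heT j) fun n => hj n hjB
  have hAU : ∀ x, A (U x) = U (a i x) := by
    refine intertwines_of_inner_eq (heT i) (fun x => ?_) fun n m => ?_
    · obtain ⟨x', hx'⟩ := (hrange (A (U x))).2 (by rw [← hA.map_proj, hUp])
      exact ⟨x', hx'.symm⟩
    · simp only [hU, map_smul]
      rw [inner_smul_left, inner_smul_right, hy, inner_mk,
        integral_eq_of_ae_eq_const_on hB (c := d n m), ← hf m i hi, ← hiy m, hid n m hi]
      · exact hr _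
      · filter_upwards [hd n m] with j hj hjB
        rw [hf n j hjB, hj hjB]
      · intro j hj
        rw [hf' n j hj, inner_zero_left]
  refine ⟨U, hrange, hAU, intertwines_of_inner_eq (heT i) (fun x => ?_) fun n m => ?_⟩
  · obtain ⟨x', hx'⟩ := (hrange (ContinuousLinearMap.adjoint A (U x))).2
      (by rw [← hA.adjoint_map_proj, hUp])
    exact ⟨x', hx'.symm⟩
  · rw [ContinuousLinearMap.adjoint_inner_right, ContinuousLinearMap.adjoint_inner_right, hAU,
      U.inner_map_map]

theorem IsDirectIntegral.ae_finrank_map_proj (hA : IsDirectIntegral A a)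
    (hB : IsFiniteAtom μ B) : ∀ᵐ i ∂μ, i ∈ B → ∀ s,
      Module.finrank ℂ ((singularEigenspace A s).map
        (proj μ F hB.measurableSet : DirectIntegral μ F →ₗ[ℂ] DirectIntegral μ F)) =
      Module.finrank ℂ (singularEigenspace (a i) s) := by
  filter_upwards [hA.ae_exists_linearIsometry hB] with i hi hiB s
  obtain ⟨U, hr, h, h'⟩ := hi hiB
  have hmap : (singularEigenspace A s).map
      (proj μ F hB.measurableSet : DirectIntegral μ F →ₗ[ℂ] DirectIntegral μ F) =
      singularEigenspace A s ⊓ LinearMap.range U.toLinearMap := ?_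
  · rw [hmap, finrank_singularEigenspace_inf_range h h' s]
  ext z
  simp only [Submodule.mem_map, Submodule.mem_inf, hr, ContinuousLinearMap.coe_coe]
  constructor
  · rintro ⟨x, hx, rfl⟩
    exact ⟨hA.proj_mem_singularEigenspace _ hx, proj_idem _ _⟩
  · rintro ⟨hz, hz'⟩
    exact ⟨z, hz, hz'⟩

omit [∀ i, CompleteSpace (H i)] in
/-- If the direct integral of `a` is zero, then `a i = 0` for some `i`. -/
theorem IsDirectIntegral.exists_eq_zero [Nontrivial (DirectIntegral μ F)]
    (hA : IsDirectIntegral (0 : DirectIntegral μ F →L[ℂ] DirectIntegral μ F) a) :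
    ∃ i, a i = 0 := by
  obtain ⟨e, heS, heT⟩ := F.exists_fundamental
  obtain ⟨z, hz⟩ := exists_ne (0 : DirectIntegral μ F)
  obtain ⟨x, rfl⟩ := mk_surjective z
  obtain ⟨N, -, hNm, hN0, hNt, -⟩ := exists_subset_forall_ne_zero (x := x) MeasurableSet.univ
    fun h => hz ((mk_eq_zero_iff x).2 (h.mono fun i hi => hi (Set.mem_univ i)))
  -- The `e n` need not be square-integrable; cutting to where they are bounded, inside a set of
  -- finite measure, makes them so. Each point of `N` lies in `D n k` for large `k`.
  let D : ℕ → ℕ → Set Λ := fun n k => N ∩ {i | ‖e n i‖ ≤ k}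
  have hD : ∀ n k, MeasurableSet (D n k) := fun n k =>
    hNm.inter (measurableSet_le (F.measurable_norm _ (heS n)) measurable_const)
  have hmem : ∀ n k, cutoff (D n k) (e n) ∈ F.l2Submodule μ := by
    intro n k
    have hm := cutoff_mem_sections (hD n k) (heS n)
    refine ⟨hm, (memLp_indicator_const 2 hNm (k : ℝ) (Or.inr hNt)).mono
      (F.measurable_norm _ hm).aestronglyMeasurable (Eventually.of_forall fun i => ?_)⟩
    by_cases hi : i ∈ D n k
    · rw [cutoff_of_mem hi, Set.indicator_of_mem hi.1]
      simpa using hi.2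
    · rw [cutoff_of_notMem hi]
      simp
  have hzero : ∀ n k, ∀ᵐ i ∂μ, a i (cutoff (D n k) (e n) i) = 0 := by
    intro n k
    have h := hA ⟨_, hmem n k⟩ 0 rfl
    exact h.mono fun i hi => hi.symm
  obtain ⟨i, hiN, hi⟩ : ∃ i ∈ N, ∀ n k, a i (cutoff (D n k) (e n) i) = 0 := by
    by_contra! hne
    refine hN0 (measure_eq_zero_iff_ae_notMem.2 ?_)
    filter_upwards [ae_all_iff.2 fun n => ae_all_iff.2 (hzero n)] with i hi hiN
    obtain ⟨n, k, h⟩ := hne i hiN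
    exact h (hi n k)
  refine ⟨i, ContinuousLinearMap.ext_on
    (Submodule.dense_iff_topologicalClosure_eq_top.2 (heT i)) ?_⟩
  rintro _ ⟨n, rfl⟩
  obtain ⟨k, hk⟩ := exists_nat_ge ‖e n i‖
  have h := hi n k
  have hiD : i ∈ D n k := ⟨hiN, hk⟩
  rw [cutoff_of_mem hiD] at h
  simpa using h

end DirectIntegral

end AtomFibre

/-! ### Families with equal multiplicities -/

section Counting

theorem encard_eq_sum_of_fibers {S : Type*} {Z : Set (S × ℕ)} {d : S → ℕ}
    (h : ∀ m, {q | (m, q) ∈ Z}.encard = d m) (F : Finset S) (hF : ∀ m, d m ≠ 0 → m ∈ F) :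
    Z.encard = (∑ m ∈ F, d m : ℕ) := by
  classical
  have hfin : ∀ m, {q | (m, q) ∈ Z}.Finite := fun m =>
    Set.finite_of_encard_eq_coe (h m)
  have hmem : ∀ x ∈ Z, x.1 ∈ F := by
    intro x hx
    refine hF _ fun h0 => ?_
    have h1 := h x.1
    rw [h0, Nat.cast_zero, Set.encard_eq_zero] at h1
    exact (h1 ▸ (show x.2 ∈ {q | (x.1, q) ∈ Z} from hx) : x.2 ∈ (∅ : Set ℕ))
  have hZ : Z = (F.sigma fun m => (hfin m).toFinset).map
      (Equiv.sigmaEquivProd S ℕ).toEmbedding := by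
    ext x
    simp only [Finset.coe_map, Set.mem_image, Finset.mem_coe, Finset.mem_sigma,
      Set.Finite.mem_toFinset]
    constructor
    · intro hx
      exact ⟨⟨x.1, x.2⟩, ⟨hmem x hx, hx⟩, rfl⟩
    · rintro ⟨y, ⟨-, hy⟩, rfl⟩
      exact hy
  rw [hZ, Set.encard_coe_eq_coe_finsetCard, Finset.card_map, Finset.card_sigma]
  congr 1
  refine Finset.sum_congr rfl fun m _ => ?_
  have := h m
  rw [(hfin m).encard_eq_coe_toFinset_card] at this
  exact_mod_cast this

theorem exists_equiv_pos_of_encard_eq {α β : Type*} {f : α → ℝ} {g : β → ℝ}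
    (h : ∀ s, 0 < s → {x | f x = s}.encard = {y | g y = s}.encard)
    (hfin : ∀ s, 0 < s → {x | f x = s}.Finite) :
    ∃ e : {x // 0 < f x} ≃ {y // 0 < g y}, ∀ x, g (e x) = f x := by
  have hex : ∀ s : ℝ, 0 < s → Nonempty ({x // f x = s} ≃ {y // g y = s}) := by
    intro s hs
    have h1 : Finite {x // f x = s} := hfin s hs
    have h2 : Finite {y // g y = s} :=
      Set.encard_lt_top_iff.1 ((h s hs) ▸ Set.encard_lt_top_iff.2 (hfin s hs))
    exact Finite.card_eq.1 (congrArg ENat.toNat (h s hs))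
  have e : ∀ s : ℝ, 0 < s → ({x // f x = s} ≃ {y // g y = s}) := fun s hs => (hex s hs).some
  have hval : ∀ s hs x, g (e s hs x).1 = s := fun s hs x => (e s hs x).2
  let φ : {x // 0 < f x} → {y // 0 < g y} := fun x =>
    ⟨(e (f x) x.2 ⟨x, rfl⟩).1, by rw [hval]; exact x.2⟩
  have hφ : ∀ x, g (φ x).1 = f x := fun x => hval _ _ _
  -- The level is made a free variable so that points with propositionally equal values can be
  -- compared through the same bijection.
  have hφe : ∀ (x : {x // 0 < f x}) s (hs : 0 < s) (hx : f x = s),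
      (φ x).1 = (e s hs ⟨x, hx⟩).1 := by
    rintro x s hs rfl
    rfl
  refine ⟨Equiv.ofBijective φ ⟨fun x y hxy => ?_, fun y => ?_⟩, hφ⟩
  · have hf : f x = f y := by rw [← hφ, ← hφ, hxy]
    have h1 := congrArg Subtype.val hxy
    rw [hφe x _ y.2 hf, hφe y _ y.2 rfl] at h1
    have h2 := (e (f y) y.2).injective (Subtype.ext h1)
    exact Subtype.ext (Subtype.mk.inj h2)
  · let x := (e (g y) y.2).symm ⟨y, rfl⟩
    refine ⟨⟨x, by rw [x.2]; exact y.2⟩, Subtype.ext ?_⟩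
    rw [hφe _ _ y.2 x.2]
    change ((e (g y) y.2) x).1 = y.1
    rw [Equiv.apply_symm_apply]

theorem summable_rpow_iff_of_encard_eq {α β : Type*} {f : α → ℝ} {g : β → ℝ}
    (hf : ∀ x, 0 ≤ f x) (hg : ∀ y, 0 ≤ g y)
    (h : ∀ s, 0 < s → {x | f x = s}.encard = {y | g y = s}.encard)
    (hfin : ∀ s, 0 < s → {x | f x = s}.Finite) {p : ℝ} (hp : p ≠ 0) :
    (Summable fun x => f x ^ p) ↔ Summable fun y => g y ^ p := by
  obtain ⟨e, he⟩ := exists_equiv_pos_of_encard_eq h hfin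
  rw [← Function.Injective.summable_iff (Subtype.val_injective (p := fun x => 0 < f x)),
    ← Function.Injective.summable_iff (Subtype.val_injective (p := fun y => 0 < g y)),
    ← e.summable_iff]
  · simp only [Function.comp_def, he]
  · intro y hy
    have : g y = 0 := le_antisymm (not_lt.1 fun h => hy ⟨⟨y, h⟩, rfl⟩) (hg y)
    rw [this, Real.zero_rpow hp]
  · intro x hx
    have : f x = 0 := le_antisymm (not_lt.1 fun h => hx ⟨⟨x, h⟩, rfl⟩) (hf x)
    rw [this, Real.zero_rpow hp]

/-- Summability puts all but finitely many `f x` in `[0, 1]`, where raising the exponent decreases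
the power. -/
theorem summable_rpow_of_exponent_le {α : Type*} {f : α → ℝ} {p : α → ℝ} {r : ℝ}
    (hf : ∀ x, 0 ≤ f x) (hp : ∀ x, 0 < p x) (hpr : ∀ x, p x ≤ r)
    (h : Summable fun x => f x ^ p x) : Summable fun x => f x ^ r := by
  refine Summable.of_norm_bounded_eventually h ?_
  filter_upwards [h.tendsto_cofinite_zero.eventually_lt_const one_pos] with x hx
  rw [Real.norm_of_nonneg (Real.rpow_nonneg (hf x) r)]
  have hx1 : f x ≤ 1 := by
    by_contra! h1
    exact hx.not_gt (Real.one_lt_rpow h1 (hp x))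
  exact Real.rpow_le_rpow_of_exponent_ge' (hf x) hx1 (hp x).le (hpr x)

end Counting

/-! ### The countable set of fibres and equality of multiplicities -/

section SingularNumbersOfDirectIntegral

variable {Λ : Type u} [MeasurableSpace Λ] {H : Λ → Type v}
  [∀ i, NormedAddCommGroup (H i)] [∀ i, InnerProductSpace ℂ (H i)] [∀ i, CompleteSpace (H i)]
  {μ : Measure Λ} {F : HilbertField Λ H}

/-- Every atom of finite measure is almost everywhere equal to a member of a suitable family of
atoms with null intersections. -/
theorem exists_family_isFiniteAtom {Λ : Type u} [MeasurableSpace Λ] (μ : Measure Λ) :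
    ∃ (Q : Type u) (B : Q → Set Λ), (∀ q, IsFiniteAtom μ (B q)) ∧
      (∀ q q', q ≠ q' → μ (B q ∩ B q') = 0) ∧ ∀ C, IsFiniteAtom μ C → ∃ q, C =ᵐ[μ] B q := by
  let r : Setoid {B : Set Λ // IsFiniteAtom μ B} :=
    { r := fun B C => B.1 =ᵐ[μ] C.1
      iseqv := ⟨fun _ => EventuallyEq.rfl, fun h => h.symm, fun h h' => h.trans h'⟩ }
  refine ⟨Quotient r, fun q => q.out.1, fun q => q.out.2, fun q q' h => ?_, fun C hC => ?_⟩
  · refine (q.out.2.ae_eq_or_inter q'.out.2).resolve_left fun h' => h ?_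
    rw [← q.out_eq, ← q'.out_eq]
    exact Quotient.sound h'
  · exact ⟨Quotient.mk r ⟨C, hC⟩, (Quotient.exact (Quotient.out_eq (Quotient.mk r ⟨C, hC⟩))).symm⟩

namespace DirectIntegral

variable {A : DirectIntegral μ F →L[ℂ] DirectIntegral μ F} {a : ∀ i, H i →L[ℂ] H i}

theorem eq_zero_of_forall_proj_eq_zero (hA : IsDirectIntegral A a) (hAc : IsCompactOperator A)
    {s : ℝ} (hs : 0 < s) {x : DirectIntegral μ F} (hx : x ∈ singularEigenspace A s)
    (h : ∀ B, ∀ hB : IsFiniteAtom μ B, proj μ F hB.measurableSet x = 0) : x = 0 := by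
  have := finiteDimensional_singularSubspace hAc hs
  -- The eigenvectors killed by every atom projection form a stable finite-dimensional space; were
  -- it nonzero, it would be nonzero over some atom.
  let V : Submodule ℂ (DirectIntegral μ F) := singularEigenspace A s ⊓
    ⨅ B : {B // IsFiniteAtom μ B},
      LinearMap.ker (proj μ F B.2.measurableSet : DirectIntegral μ F →ₗ[ℂ] DirectIntegral μ F)
  have hV : ∀ z, z ∈ V ↔ z ∈ singularEigenspace A s ∧
      ∀ B, ∀ hB : IsFiniteAtom μ B, proj μ F hB.measurableSet z = 0 := by
    intro z
    simp [V, Submodule.mem_iInf]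
  have : FiniteDimensional ℂ V := Submodule.finiteDimensional_of_le
    (inf_le_left.trans (singularEigenspace_le A le_rfl))
  by_contra hx0
  obtain ⟨B, hB, z, hz, hz0⟩ := exists_isFiniteAtom_of_proj_mem (V := V)
    (fun hb => hx0 ((Submodule.mem_bot ℂ).1 (hb ▸ (hV x).2 ⟨hx, h⟩))) fun C hC y hy => by
      rw [hV] at hy ⊢
      refine ⟨hA.proj_mem_singularEigenspace hC hy.1, fun B hB => ?_⟩
      rw [proj_comm, hy.2 B hB, map_zero]
  exact hz0 (((hV z).1 hz).2 B hB)

theorem IsDirectIntegral.exists_countable_encard_eq [Nontrivial (DirectIntegral μ F)]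
    (hA : IsDirectIntegral A a) (ha : ∀ i, IsCompactOperator (a i)) (hAc : IsCompactOperator A) :
    ∃ S : Set Λ, S.Countable ∧ S.Nonempty ∧
      ∀ s : ℝ, 0 < s → {k : ℕ | singularNumber A k = s}.encard =
        {mq : S × ℕ | singularNumber (a mq.1) mq.2 = s}.encard := by
  obtain ⟨Q, B, hB, hdisj, hex⟩ := exists_family_isFiniteAtom μ
  let P : Q → DirectIntegral μ F →ₗ[ℂ] DirectIntegral μ F := fun q =>
    (proj μ F (hB q).measurableSet : DirectIntegral μ F →ₗ[ℂ] DirectIntegral μ F)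
  have hfd : ∀ s, 0 < s → FiniteDimensional ℂ (singularEigenspace A s) := fun s hs =>
    have := finiteDimensional_singularSubspace hAc hs
    Submodule.finiteDimensional_of_le (singularEigenspace_le A le_rfl)
  have hle : ∀ s q, (singularEigenspace A s).map (P q) ≤ singularEigenspace A s := by
    rintro s q _ ⟨x, hx, rfl⟩
    exact hA.proj_mem_singularEigenspace _ hx
  have hidem : ∀ q x, P q (P q x) = P q x := fun q x => proj_idem _ x
  have horth : ∀ q q', q ≠ q' → ∀ x, P q (P q' x) = 0 := by
    intro q q' h x
    exact (proj_proj _ _ x).trans (proj_eq_zero _ (hdisj q q' h) x)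
  have hzero : ∀ s, 0 < s → ∀ x ∈ singularEigenspace A s, (∀ q, P q x = 0) → x = 0 := by
    intro s hs x hx h
    refine eq_zero_of_forall_proj_eq_zero hA hAc hs hx fun C hC => ?_
    obtain ⟨q, hq⟩ := hex C hC
    rw [proj_congr _ (hB q).measurableSet hq]
    exact h q
  let I : Set Q := {q | ∃ s, 0 < s ∧ (singularEigenspace A s).map (P q) ≠ ⊥}
  have hfin : ∀ s, 0 < s → {q | (singularEigenspace A s).map (P q) ≠ ⊥}.Finite := fun s hs =>
    have := hfd s hs
    finite_setOf_map_ne_bot (hle s) hidem horth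
  -- There are countably many positive singular values, and each eigenspace meets finitely many of
  -- the atoms.
  have hI : I.Countable := by
    have hc : {s : ℝ | 0 < s ∧ singularEigenspace A s ≠ ⊥}.Countable := by
      have : {s : ℝ | 0 < s ∧ singularEigenspace A s ≠ ⊥} ⊆
          ⋃ n : ℕ, {s : ℝ | 1 / ((n : ℝ) + 1) ≤ s ∧ singularEigenspace A s ≠ ⊥} := by
        rintro s ⟨hs, hs'⟩
        obtain ⟨n, hn⟩ := exists_nat_one_div_lt hs
        exact Set.mem_iUnion.2 ⟨n, hn.le, hs'⟩
      exact (Set.countable_iUnion fun n => (finite_setOf_singularEigenspace_ne_bot hAc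
        Nat.one_div_pos_of_nat).countable).mono this
    refine (hc.biUnion fun s hs => (hfin s hs.1).countable).mono ?_
    rintro q ⟨s, hs, hq⟩
    refine Set.mem_biUnion (x := s) ⟨hs, fun hb => hq ?_⟩ hq
    rw [hb, Submodule.map_bot]
  -- The atoms overlap only in null sets. As `I` is countable, the point can be chosen off all the
  -- other atoms, which makes `l` injective, so no multiplicity is lost.
  have hpt : ∀ q : I, ∃ i ∈ B q, (∀ s, Module.finrank ℂ ((singularEigenspace A s).map (P q)) =
      Module.finrank ℂ (singularEigenspace (a i) s)) ∧ ∀ q' : I, q' ≠ q → i ∉ B q' := by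
    intro q
    have : Countable I := hI.to_subtype
    by_contra! hne
    refine (hB q).ne_zero (measure_eq_zero_iff_ae_notMem.2 ?_)
    have hd : ∀ᵐ i ∂μ, ∀ q' : I, q' ≠ q → i ∈ B q → i ∉ B q' := by
      refine ae_all_iff.2 fun q' => ?_
      by_cases hqq : q' = q
      · exact Eventually.of_forall fun i h => absurd hqq h
      · filter_upwards [measure_eq_zero_iff_ae_notMem.1
          (hdisj q q' fun h => hqq (Subtype.ext h.symm))] with i hi _ h1 h2
        exact hi ⟨h1, h2⟩
    filter_upwards [hA.ae_finrank_map_proj (hB q), hd] with i h1 h2 hi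
    obtain ⟨q', hq', hi'⟩ := hne i hi (h1 hi)
    exact h2 q' hq' hi hi'
  choose l hlB hlf hln using hpt
  have hlinj : Function.Injective l := by
    intro q q' h
    by_contra hqq
    exact hln q q' (Ne.symm hqq) (h ▸ hlB q')
  rcases isEmpty_or_nonempty I with hIe | hIn
  · have hbot : ∀ s, 0 < s → singularEigenspace A s = ⊥ := by
      intro s hs
      refine (Submodule.eq_bot_iff _).2 fun x hx => hzero s hs x hx fun q => ?_
      by_contra hq
      refine hIe.false ⟨q, s, hs, fun hb => hq ?_⟩
      exact (Submodule.mem_bot ℂ).1 (hb ▸ Submodule.mem_map_of_mem hx)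
    obtain rfl := eq_zero_of_forall_singularEigenspace_eq_bot hAc hbot
    -- With `A = 0` no atom contributes, but `S` must be nonempty: a fibre with `a i = 0` adds no
    -- positive singular number.
    obtain ⟨i, hi⟩ := hA.exists_eq_zero
    refine ⟨{i}, Set.countable_singleton i, Set.singleton_nonempty i, fun s hs => ?_⟩
    rw [encard_setOf_singularNumber_eq hAc hs, hbot s hs, finrank_bot,
      encard_eq_sum_of_fibers (d := fun _ => 0) (fun m => ?_) ∅ (by simp)]
    · simp
    · have hm : a m = 0 := by
        obtain ⟨m, rfl⟩ := m
        exact hi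
      have := encard_setOf_singularNumber_eq (ha m) hs
      rw [hm, singularEigenspace_zero hs, finrank_bot] at this
      rw [← this]
      simp [hm]
  · refine ⟨Set.range l, ?_, Set.range_nonempty l, fun s hs => ?_⟩
    · have : Countable I := hI.to_subtype
      exact Set.countable_range l
    have := hfd s hs
    have hfinI : {q : I | (singularEigenspace A s).map (P q) ≠ ⊥}.Finite :=
      (hfin s hs).preimage Subtype.val_injective.injOn
    let emb : I ↪ Set.range l := ⟨fun q => ⟨l q, q, rfl⟩, fun q q' h =>
      hlinj (congrArg Subtype.val h)⟩
    rw [encard_setOf_singularNumber_eq hAc hs,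
      finrank_eq_sum_finrank_map (P := fun q : I => P q) (fun q => hle s q) (fun q => hidem q)
        (fun q q' h => horth q q' fun h' => h (Subtype.ext h'))
        (fun x hx h => hzero s hs x hx fun q => ?_) hfinI.toFinset
        (fun q hq => hfinI.mem_toFinset.2 hq),
      encard_eq_sum_of_fibers
        (d := fun m : Set.range l => Module.finrank ℂ (singularEigenspace (a m) s))
        (fun m => encard_setOf_singularNumber_eq (ha m) hs) (hfinI.toFinset.map emb) ?_,
      Finset.sum_map]
    · simp only [hlf]
      rfl
    · rintro ⟨_, q, rfl⟩ hm
      refine Finset.mem_map.2 ⟨q, hfinI.mem_toFinset.2 fun hb => hm ?_, rfl⟩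
      rw [← hlf, hb, finrank_bot]
    · by_cases hq : q ∈ I
      · exact h ⟨q, hq⟩
      · by_contra hq0
        refine hq ⟨s, hs, fun hb => hq0 ?_⟩
        exact (Submodule.mem_bot ℂ).1 (hb ▸ Submodule.mem_map_of_mem hx)

end DirectIntegral

end SingularNumbersOfDirectIntegral

/-! ### Consequences for Schatten classes -/

section SchattenClass

theorem toReal_pos_of_one_le {p : ℝ≥0∞} (h : 1 ≤ p) (h' : p < ∞) : 0 < p.toReal :=
  ENNReal.toReal_pos (one_pos.trans_le h).ne' h'.ne

variable {G : Type*} [NormedAddCommGroup G] [InnerProductSpace ℂ G] [CompleteSpace G]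
  {A : G →L[ℂ] G} {S : Type*} {K : S → Type*} [∀ m, NormedAddCommGroup (K m)]
  [∀ m, InnerProductSpace ℂ (K m)] [∀ m, CompleteSpace (K m)] {b : ∀ m, K m →L[ℂ] K m}

theorem mem_schattenClass_iff_summable (hA : IsCompactOperator A)
    (h : ∀ s : ℝ, 0 < s → {k : ℕ | singularNumber A k = s}.encard =
      {mq : S × ℕ | singularNumber (b mq.1) mq.2 = s}.encard)
    {p : ℝ≥0∞} (hp : 1 ≤ p) (hp' : p < ∞) : A ∈ schattenClass G p ↔
      Summable fun mq : S × ℕ => singularNumber (b mq.1) mq.2 ^ p.toReal := by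
  have hiff := summable_rpow_iff_of_encard_eq (singularNumber_nonneg A)
    (fun mq : S × ℕ => singularNumber_nonneg (b mq.1) mq.2) h
    (fun s hs => Set.finite_of_encard_eq_coe (encard_setOf_singularNumber_eq hA hs))
    (toReal_pos_of_one_le hp hp').ne'
  exact ⟨fun h => hiff.1 (h.2 hp'.ne), fun h => ⟨hA, fun _ => hiff.2 h⟩⟩

theorem mem_schattenClass_of_summable (hb : ∀ m, IsCompactOperator (b m)) {p : ℝ≥0∞}
    (h : Summable fun mq : S × ℕ => singularNumber (b mq.1) mq.2 ^ p.toReal) (m : S) :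
    b m ∈ schattenClass (K m) p := by
  have h' := h.comp_injective (Prod.mk_right_injective m)
  simp only [Function.comp_def] at h'
  exact ⟨hb m, fun _ => h'⟩

theorem mem_schattenClass_iSup [Nonempty S] (hA : IsCompactOperator A)
    (h : ∀ s : ℝ, 0 < s → {k : ℕ | singularNumber A k = s}.encard =
      {mq : S × ℕ | singularNumber (b mq.1) mq.2 = s}.encard)
    {p : S → ℝ≥0∞} (hp : ∀ m, 1 ≤ p m ∧ p m < ∞) (hsup : (⨆ m, p m) < ∞)
    (hsum : Summable fun mq : S × ℕ => singularNumber (b mq.1) mq.2 ^ (p mq.1).toReal) :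
    A ∈ schattenClass G (⨆ m, p m) := by
  obtain ⟨m₀⟩ := ‹Nonempty S›
  refine (mem_schattenClass_iff_summable hA h ((hp m₀).1.trans (le_iSup p _)) hsup).2 ?_
  exact summable_rpow_of_exponent_le
    (fun mq : S × ℕ => singularNumber_nonneg (b mq.1) mq.2)
    (fun mq => toReal_pos_of_one_le (hp mq.1).1 (hp mq.1).2)
    (fun mq => ENNReal.toReal_mono hsup.ne (le_iSup p mq.1)) hsum

/-- Membership of `A` in `C_r` passes to every `b m`, so every critical exponent `p m` is at most
`r`, and so is their supremum. -/
theorem notMem_schattenClass_of_iSup_eq_top (hA : IsCompactOperator A)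
    (hb : ∀ m, IsCompactOperator (b m))
    (h : ∀ s : ℝ, 0 < s → {k : ℕ | singularNumber A k = s}.encard =
      {mq : S × ℕ | singularNumber (b mq.1) mq.2 = s}.encard)
    {p : S → ℝ≥0∞}
    (hp : ∀ m, p m = sInf {r : ℝ≥0∞ | 1 ≤ r ∧ r < ∞ ∧ b m ∈ schattenClass (K m) r})
    (hsup : (⨆ m, p m) = ∞) {r : ℝ≥0∞} (hr : 1 ≤ r) (hr' : r < ∞) :
    A ∉ schattenClass G r := by
  intro hAr
  refine hr'.not_ge (hsup ▸ iSup_le fun m => ?_)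
  rw [hp m]
  exact sInf_le ⟨hr, hr', mem_schattenClass_of_summable hb
    ((mem_schattenClass_iff_summable hA h hr hr').1 hAr) m⟩

theorem summable_of_mem_schattenClass [Finite S] {p : S → ℝ≥0∞} (hp : ∀ m, p m < ∞)
    (h : ∀ m, b m ∈ schattenClass (K m) (p m)) :
    Summable fun mq : S × ℕ => singularNumber (b mq.1) mq.2 ^ (p mq.1).toReal := by
  rw [summable_prod_of_nonneg fun mq => Real.rpow_nonneg (singularNumber_nonneg _ _) _]
  exact ⟨fun m => (h m).2 (hp m).ne, Summable.of_finite⟩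

theorem iSup_lt_top_of_finite [Finite S] [Nonempty S] {p : S → ℝ≥0∞} (hp : ∀ m, p m < ∞) :
    (⨆ m, p m) < ∞ := by
  obtain ⟨m, hm⟩ := Finite.exists_max p
  exact (iSup_le hm).trans_lt (hp m)

end SchattenClass

/-! ### The main theorem -/

theorem theorem3p5 {Λ : Type u} [MeasurableSpace Λ] (μ : Measure Λ) {H : Λ → Type v}
    [∀ i, NormedAddCommGroup (H i)] [∀ i, InnerProductSpace ℂ (H i)] [∀ i, CompleteSpace (H i)]
    (F : HilbertField Λ H) [Nontrivial (DirectIntegral μ F)]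
    (a : ∀ i, H i →L[ℂ] H i) (A : DirectIntegral μ F →L[ℂ] DirectIntegral μ F)
    (hA : DirectIntegral.IsDirectIntegral A a)
    (ha_compact : ∀ i, a i ∈ schattenClass (H i) ∞)
    (hA_compact : A ∈ schattenClass (DirectIntegral μ F) ∞) :
    ∃ S : Set Λ, S.Countable ∧ S.Nonempty ∧
      -- (1) equality of the nonzero singular numbers, with multiplicities
      (∀ s : ℝ, 0 < s → {k : ℕ | singularNumber A k = s}.encard =
        {mq : S × ℕ | singularNumber (a mq.1) mq.2 = s}.encard) ∧
      -- (2)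
      (∀ p : ℝ≥0∞, 1 ≤ p → p < ∞ → A ∈ schattenClass (DirectIntegral μ F) p →
        ∀ m : S, a m ∈ schattenClass (H m) p) ∧
      -- (3) finite `S`, variable exponents
      (S.Finite → ∀ p : S → ℝ≥0∞, (∀ m, 1 ≤ p m ∧ p m < ∞) →
        (∀ m : S, a m ∈ schattenClass (H m) (p m)) →
        (A ∈ schattenClass (DirectIntegral μ F) (⨆ m, p m) ↔
          Summable fun mq : S × ℕ => singularNumber (a mq.1) mq.2 ^ (p mq.1).toReal)) ∧
      -- (3) countable `S`, one exponent
      (∀ p : ℝ≥0∞, 1 ≤ p → p < ∞ →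
        (A ∈ schattenClass (DirectIntegral μ F) p ↔
          Summable fun mq : S × ℕ => singularNumber (a mq.1) mq.2 ^ p.toReal)) ∧
      -- (4)
      (∀ p : S → ℝ≥0∞, (∀ m, 1 ≤ p m ∧ p m < ∞) →
        (∀ m : S, a m ∈ schattenClass (H m) (p m)) → (⨆ m, p m) < ∞ →
        (Summable fun mq : S × ℕ => singularNumber (a mq.1) mq.2 ^ (p mq.1).toReal) →
        A ∈ schattenClass (DirectIntegral μ F) (⨆ m, p m)) ∧
      -- (5)
      (∀ p : S → ℝ≥0∞, (∀ m, 1 ≤ p m ∧ p m < ∞) →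
        (∀ m : S, a m ∈ schattenClass (H m) (p m)) →
        (∀ m : S, p m = sInf {r : ℝ≥0∞ | 1 ≤ r ∧ r < ∞ ∧ a m ∈ schattenClass (H m) r}) →
        (⨆ m, p m) = ∞ →
        ∀ r : ℝ≥0∞, 1 ≤ r → r < ∞ → A ∉ schattenClass (DirectIntegral μ F) r) ∧
      -- (6)
      (∀ p : S → ℝ≥0∞, (∀ m, 1 ≤ p m) →
        (∀ m : S, a m ∈ schattenClass (H m) (p m)) →
        (∀ m : S, p m = sInf {r : ℝ≥0∞ | 1 ≤ r ∧ r < ∞ ∧ a m ∈ schattenClass (H m) r}) →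
        (⨆ m, p m) = ∞ → (∃ k : S, a k ∈ schattenClass (H k) ∞) →
        ∀ r : ℝ≥0∞, 1 ≤ r → r < ∞ → A ∉ schattenClass (DirectIntegral μ F) r) := by
  obtain ⟨S, hSc, hSn, hS⟩ := hA.exists_countable_encard_eq (fun i => (ha_compact i).1) hA_compact.1
  have hSne : Nonempty S := hSn.to_subtype
  have hb : ∀ m : S, IsCompactOperator (a m) := fun m => (ha_compact m).1
  refine ⟨S, hSc, hSn, hS, fun p hp hp' hAp => ?_, fun hfin p hp hap => ⟨fun _ => ?_, fun h => ?_⟩,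
    fun p hp hp' => ?_, fun p hp _ hsup hsum => ?_, fun p _ _ hpi hsup r hr hr' => ?_,
    fun p _ _ hpi hsup _ r hr hr' => ?_⟩
  · exact mem_schattenClass_of_summable (b := fun m : S => a m) hb
      ((mem_schattenClass_iff_summable (b := fun m : S => a m) hA_compact.1 hS hp hp').1 hAp)
  · have : Finite S := hfin
    exact summable_of_mem_schattenClass (b := fun m : S => a m) (fun m => (hp m).2) hap
  · have : Finite S := hfin
    exact mem_schattenClass_iSup (b := fun m : S => a m) hA_compact.1 hS hp (iSup_lt_top_of_finite fun m => (hp m).2) h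
  · exact mem_schattenClass_iff_summable (b := fun m : S => a m) hA_compact.1 hS hp hp'
  · exact mem_schattenClass_iSup (b := fun m : S => a m) hA_compact.1 hS hp hsup hsum
  -- In `ℝ≥0∞` the infimum of the empty set is `∞`, so the same argument covers finite and infinite
  -- critical exponents.
  · exact notMem_schattenClass_of_iSup_eq_top (b := fun m : S => a m) hA_compact.1 hb hS hpi hsup hr hr'
  · exact notMem_schattenClass_of_iSup_eq_top (b := fun m : S => a m) hA_compact.1 hb hS hpi hsup hr hr'
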